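/- Let $p$ be an odd prime, $k\ge 1$, $q=p^k$, and let $\varphi:x\mapsto x^p$ be the Frobenius automorphism of $\mathbb{F}_q$. Let $\Gamma\mathrm{L}(2,q)=\mathrm{GL}(2,q)\rtimes\langle\varphi\rangle$, where $\varphi$ acts on matrices entrywise, act on the set $\Omega$ of non-zero vectors of $\mathbb{F}_q^2$ by $(A\varphi^i)v=A\,v^{\varphi^i}$, with $\varphi^i$ applied entrywise to $v$. A set $\mathcal F\subseteq\Gamma\mathrm{L}(2,q)$ is intersecting if for all $g,h\in\mathcal F$ there is $v\in\Omega$ with $g(v)=h(v)$; it is a maximum intersecting set if it is intersecting and no intersecting set has more elements. Fix a generator $\omega$ of $\mathbb{F}_q^*$, and for integers $i,t\ge 0$ and $0\le j\le k-1$ let $$V_{i,j}=\Big\{\omega^i\varphi^j\begin{bmatrix}1&z\\0&y\end{bmatrix}: z\in\mathbb{F}_q,\ y\in\mathbb{F}_q^*\Big\},\qquad H_{t,j}=\Big\{\varphi^j\begin{bmatrix}x&z\\0&\omega^t\end{bmatrix}: x\in\mathbb{F}_q^*,\ z\in\mathbb{F}_q\Big\},$$ where $\omega^i$ stands for the scalar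 matrix; the first index only matters modulo $q-1$. Call a sequence $(r_0,\dots,r_{k-1})$ of non-negative integers admissible if * $r_0=0$; * $r_j\le \frac{q-1}{p^{\gcd(j,k)}-1}-1$ for $0\le j\le k-1$; * $r_j(p^j-1)\equiv r_{j'}(p^{j'}-1) \pmod{p^{j'-j}-1}$ for $0\le j<j'\le k-1$, as a congruence in $\mathbb{Z}/(q-1)\mathbb{Z}$; that is, the difference of the two sides is a multiple of $p^{j'-j}-1$ in the ring $\mathbb{Z}/(q-1)\mathbb{Z}$ (equivalently, the two integers are congruent modulo $\gcd(p^{j'-j}-1,q-1)=p^{\gcd(j'-j,k)}-1$). Then: 1. $\Gamma\mathrm{L}(2,q)$ acting on $\Omega$ has the EKR property: every intersecting set has size at most that of a point stabilizer. Each point stabilizer has size $kq(q-1)$, so every intersecting set has size at most $kq(q-1)$, and the maximum intersecting sets are exactly the intersecting sets of this size. 2. If $\mathcal F$ is a maximum intersecting set and $f\in\mathcal F$, then there is $g\in\Gamma\mathrm{L}(2,q)$ such that $g f^{-1}\mathcal F g^{-1}$ is of one of the following two types: * vertical type: $V_{0,0}\cup V_{r_1(p-1),1}\cup\dots\cup V_{r_j(p^j-1),j}\cup\dots\cup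 V_{r_{k-1}(p^{k-1}-1),k-1}$ with $(r_0,\dots,r_{k-1})$ admissible; * horizontal type: $H_{0,0}\cup H_{t_1(p-1),1}\cup\dots\cup H_{t_j(p^j-1),j}\cup\dots\cup H_{t_{k-1}(p^{k-1}-1),k-1}$ with $(t_0,\dots,t_{k-1})$ admissible. 3. Conversely, every set of vertical or horizontal type is a maximum intersecting set. -/

import Mathlib

noncomputable section

/-! ### Intersecting sets in a group acting on a set -/

section Intersecting

variable {G : Type*} [Group G] (Ω : Type*) [MulAction G Ω]

/-- A set of group elements is intersecting if any two of its elements agree on some point. -/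
def IsIntersecting (S : Set G) : Prop :=
  ∀ g ∈ S, ∀ h ∈ S, ∃ w : Ω, g • w = h • w

/-- An intersecting set of the largest possible size. -/
def IsMaximumIntersecting (S : Set G) : Prop :=
  IsIntersecting Ω S ∧ ∀ T : Set G, IsIntersecting Ω T → T.ncard ≤ S.ncard

variable (G) in
/-- The EKR property: no intersecting set is larger than a point stabilizer. -/
def HasEKR : Prop :=
  ∀ S : Set G, IsIntersecting Ω S → ∀ w : Ω, S.ncard ≤ Nat.card (MulAction.stabilizer G w)

end Intersecting

/-! ### The semilinear group `ΓL(2, F)` -/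

section Semilinear

open Matrix

/-- Ring automorphisms of `F` act on `GL(2, F)` entrywise. -/
def entrywise (F : Type*) [Field F] : RingAut F →* MulAut (GL (Fin 2) F) where
  toFun σ := Units.mapEquiv (RingEquiv.mapMatrix (m := Fin 2) σ).toMulEquiv
  map_one' := by ext; rfl
  map_mul' _ _ := by ext; rfl

variable (p : ℕ) [Fact p.Prime] (F : Type*) [Field F] [Fintype F] [CharP F p]

/-- The Frobenius automorphism `x ↦ x ^ p` of the finite field `F`. -/
def frob : RingAut F := frobeniusEquiv F p

/-- `ΓL(2, F) = GL(2, F) ⋊ ⟨φ⟩`, where `φ` is the Frobenius automorphism. -/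
abbrev GammaL : Type _ :=
  SemidirectProduct (GL (Fin 2) F) (Subgroup.zpowers (frob p F))
    ((entrywise F).comp (Subgroup.zpowers (frob p F)).subtype)

/-- The nonzero vectors of `F ^ 2`. -/
abbrev NonzeroVec : Type _ := {v : Fin 2 → F // v ≠ 0}

variable {p F}

theorem mulVec_comp_ne_zero (A : GL (Fin 2) F) (σ : RingAut F) {v : Fin 2 → F} (hv : v ≠ 0) :
    (A : Matrix (Fin 2) (Fin 2) F) *ᵥ (fun i => σ (v i)) ≠ 0 := by
  intro h
  apply hv
  have h2 := congrArg (fun w => ((A⁻¹ : GL (Fin 2) F) : Matrix (Fin 2) (Fin 2) F) *ᵥ w) h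
  simp only [mulVec_mulVec, ← Units.val_mul, inv_mul_cancel, Units.val_one, one_mulVec,
    mulVec_zero] at h2
  funext i
  have h3 := congrFun h2 i
  simpa using h3

/-- The element `A σ` acts on nonzero vectors by applying `σ` entrywise and then `A`. -/
instance : MulAction (GammaL p F) (NonzeroVec F) where
  smul g v := ⟨(g.left : Matrix (Fin 2) (Fin 2) F) *ᵥ (fun i => (g.right : RingAut F) (v.1 i)),
    mulVec_comp_ne_zero g.left g.right v.2⟩
  one_smul v := by
    apply Subtype.ext
    change ((1 : GL (Fin 2) F) : Matrix (Fin 2) (Fin 2) F) *ᵥ (fun i => (1 : RingAut F) (v.1 i))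
      = v.1
    simp
  mul_smul g h v := by
    apply Subtype.ext
    change ((g.left * entrywise F (g.right : RingAut F) h.left : GL (Fin 2) F) :
        Matrix (Fin 2) (Fin 2) F) *ᵥ
          (fun i => ((g.right : RingAut F) * (h.right : RingAut F)) (v.1 i)) =
      (g.left : Matrix (Fin 2) (Fin 2) F) *ᵥ (fun i => (g.right : RingAut F)
        (((h.left : Matrix (Fin 2) (Fin 2) F) *ᵥ fun i => (h.right : RingAut F) (v.1 i)) i))
    rw [Units.val_mul, ← mulVec_mulVec]
    congr 1
    funext i
    simp [mulVec, dotProduct, entrywise]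

/-- The upper triangular matrix with rows `(x, z)` and `(0, y)`. -/
def upperTri (x : Fˣ) (z : F) (y : Fˣ) : GL (Fin 2) F :=
  GeneralLinearGroup.mkOfDetNeZero !![(x : F), z; 0, (y : F)] (by simp [det_fin_two])

variable (p) in
/-- A matrix, as an element of `ΓL(2, F)`. -/
def ofGL (A : GL (Fin 2) F) : GammaL p F := SemidirectProduct.inl A

variable (p F) in
/-- The power `φ ^ j` of the Frobenius automorphism, as an element of `ΓL(2, F)`. -/
def frobPow (j : ℕ) : GammaL p F :=
  SemidirectProduct.inr ⟨frob p F ^ j, j, by simp⟩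

variable (p) in
/-- `V_{i,j}`: all `ω ^ i φ ^ j [1 z; 0 y]` with `z ∈ F` and `y ∈ Fˣ`.
It depends on `i` only modulo the order of `ω`. -/
def vSet (ω : Fˣ) (i j : ℕ) : Set (GammaL p F) :=
  {g | ∃ (z : F) (y : Fˣ),
    g = ofGL p (GeneralLinearGroup.scalar (Fin 2) (ω ^ i)) * frobPow p F j * ofGL p (upperTri 1 z y)}

variable (p) in
/-- `H_{t,j}`: all `φ ^ j [x z; 0 ω ^ t]` with `x ∈ Fˣ` and `z ∈ F`.
It depends on `t` only modulo the order of `ω`. -/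
def hSet (ω : Fˣ) (t j : ℕ) : Set (GammaL p F) :=
  {g | ∃ (x : Fˣ) (z : F), g = frobPow p F j * ofGL p (upperTri x z (ω ^ t))}

/-- The conditions on the parameters `r_0, …, r_{k-1}`, where `q = p ^ k`. The numbers
`r_j (p ^ j - 1)` are exponents of an element of order `q - 1`, so that they are residue
classes modulo `q - 1`, and their congruence modulo `p ^ (j' - j) - 1` is
divisibility of the difference by `p ^ (j' - j) - 1` in `ℤ/(q-1)ℤ`. -/
def Admissible (p k : ℕ) (r : ℕ → ℕ) : Prop :=
  r 0 = 0 ∧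
  (∀ j < k, r j ≤ (p ^ k - 1) / (p ^ Nat.gcd j k - 1) - 1) ∧
  ∀ j j', j < j' → j' < k →
    ((p : ZMod (p ^ k - 1)) ^ (j' - j) - 1) ∣
      ((r j : ZMod (p ^ k - 1)) * ((p : ZMod (p ^ k - 1)) ^ j - 1)
        - (r j' : ZMod (p ^ k - 1)) * ((p : ZMod (p ^ k - 1)) ^ j' - 1))

/-- `V_{0,0} ∪ V_{r_1(p-1),1} ∪ … ∪ V_{r_{k-1}(p^{k-1}-1),k-1}` with admissible `r`. -/
def IsVerticalType (k : ℕ) (ω : Fˣ) (S : Set (GammaL p F)) : Prop :=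
  ∃ r : ℕ → ℕ, Admissible p k r ∧ S = ⋃ j ∈ Finset.range k, vSet p ω (r j * (p ^ j - 1)) j

/-- `H_{0,0} ∪ H_{t_1(p-1),1} ∪ … ∪ H_{t_{k-1}(p^{k-1}-1),k-1}` with admissible `t`. -/
def IsHorizontalType (k : ℕ) (ω : Fˣ) (S : Set (GammaL p F)) : Prop :=
  ∃ t : ℕ → ℕ, Admissible p k t ∧ S = ⋃ j ∈ Finset.range k, hSet p ω (t j * (p ^ j - 1)) j

end Semilinear

end

/-! Let q be the order of `F`. Two elements of an intersecting set with the same automorphism `σ`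
agree at a nonzero vector, so the difference of their matrices is singular. A family of invertible 2
× 2 matrices with singular differences lies in a vertical family `A u = w` or in its transposed,
horizontal counterpart (`subset_vertFix_or_horFix`), each of size q(q - 1). Summing over the k
automorphisms gives the bound, and equality forces every fiber to be a full family of one of these
kinds.

The involution `A ↦ A / det A` exchanges the two kinds and preserves agreement of semilinear maps
(`exists_agree_detTwist`), so only the vertical case needs work. After translation and conjugation
the fiber over 1 is the stabilizer of the first basis vector e. For `σ ≠ 1`, any fiber other than a
family `A e = a e` contains some `B` for which `A⁻¹ B σ` fixes only zero, for a suitable `A` fixing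
e (`exists_unit_eq_vertFix_of_agree`). Hence the set is determined by eigenvalues `a σ`, and it is
intersecting exactly when each equation `a σ * σ c = a τ * τ c` has a nonzero solution `c`.

Taking logarithms to the base `ω` turns these equations into linear equations modulo q - 1, whose
solvability is the admissibility condition (`exists_agree_iff_dvd`). Oddness of p enters through
`exists_unit_forall_eq_zero`, which supplies the maps without fixed vectors. -/

open Matrix

/-! ### Units avoiding ratios of field automorphisms. -/

section FieldAutomorphisms

variable {F : Type*} [Field F] [Finite F]

/-- The self-map `c ↦ σ c / τ c` of the finite set `Fˣ` identifies 1 and -1, so it is not injective,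
hence not surjective; `y` is any value it misses. -/
theorem exists_unit_forall_eq_zero (h2 : (2 : F) ≠ 0) (σ τ : RingAut F) :
    ∃ y : Fˣ, ∀ c : F, y * τ c = σ c → c = 0 := by
  by_contra! H
  choose c hc hc0 using H
  let f : Fˣ → Fˣ := fun c => Units.map (σ : F →* F) c / Units.map (τ : F →* F) c
  have hsurj : Function.Surjective f := by
    intro y
    refine ⟨Units.mk0 (c y) (hc0 y), ?_⟩
    rw [div_eq_iff_eq_mul]
    ext
    simpa using (hc y).symm
  have hinj := Finite.injective_iff_surjective.2 hsurj
  have h1 : f (-1) = f 1 := by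
    simp only [f, div_eq_iff_eq_mul]
    ext
    simp
  have h3 := congrArg Units.val (hinj h1)
  apply h2
  simp only [Units.val_neg, Units.val_one] at h3
  linear_combination -h3

/-- `y` is not of the form `c / σ c`. -/
def NotRatio (σ : RingAut F) (y : F) : Prop := ∀ c : F, y * σ c = c → c = 0

theorem exists_notRatio (h2 : (2 : F) ≠ 0) (σ : RingAut F) :
    ∃ y : F, y ≠ 0 ∧ NotRatio σ y := by
  obtain ⟨y, hy⟩ := exists_unit_forall_eq_zero h2 1 σ
  exact ⟨y, y.ne_zero, fun c hc => hy c (by simpa using hc)⟩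

theorem exists_pair_notRatio (h2 : (2 : F) ≠ 0) {σ : RingAut F} (hσ : σ ≠ 1) :
    ∃ a d : F, a ≠ 0 ∧ d ≠ 0 ∧ a ≠ d ∧ NotRatio σ a ∧ NotRatio σ d := by
  obtain ⟨y, hy0, hy⟩ := exists_notRatio h2 σ
  obtain ⟨e, he⟩ : ∃ e, σ e ≠ e := by
    by_contra! H
    exact hσ (RingEquiv.ext H)
  have he0 : e ≠ 0 := by rintro rfl; simp at he
  have hs0 : σ e ≠ 0 := by simpa using he0
  -- Multiplying by `σ e / e` preserves `NotRatio` (replace `c` by `e * c`), and changes `y` because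
  -- `σ` moves `e`.
  refine ⟨y, y * (σ e / e), hy0, by simp [*], ?_, hy, ?_⟩
  · intro h
    apply he
    field_simp at h
    exact h.symm
  · intro c hc
    have := hy (e * c) (by
      rw [map_mul]
      field_simp at hc
      linear_combination hc)
    simpa [he0] using this

theorem exists_notRatio_sq (h2 : (2 : F) ≠ 0) (σ : RingAut F) {b : F} (hb : b ≠ 0) :
    ∃ c : F, c ≠ 0 ∧ ∀ t, b * σ (c * σ t) = t → t = 0 := by
  obtain ⟨y, hy0, hy⟩ := exists_notRatio h2 σ
  -- This choice turns the equation into `y * σ (σ t) = t`; multiplying by `σ t` shows that `t * σ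
  -- t` is a solution of `y * σ c = c`.
  refine ⟨σ.symm (y / b), by simp [*], fun t ht => ?_⟩
  have := hy (t * σ t) (by
    rw [map_mul, RingEquiv.apply_symm_apply] at ht
    rw [map_mul]
    field_simp at ht
    linear_combination (σ t) * ht)
  simpa using this

end FieldAutomorphisms

/-! ### Vertical and horizontal families of matrices and their sizes. -/

section Coordinates

variable {F : Type*} [Field F]

theorem mulVec_fin_two_eq_iff (A : Matrix (Fin 2) (Fin 2) F) (u w : Fin 2 → F) :
    A *ᵥ u = w ↔ A 0 0 * u 0 + A 0 1 * u 1 = w 0 ∧ A 1 0 * u 0 + A 1 1 * u 1 = w 1 := by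
  simp [funext_iff, Fin.forall_fin_two]

theorem fin_two_ne_zero_iff (u : Fin 2 → F) : u ≠ 0 ↔ u 0 ≠ 0 ∨ u 1 ≠ 0 := by
  simp only [ne_eq, funext_iff, Fin.forall_fin_two, Pi.zero_apply]
  tauto

/-- The first standard basis vector. -/
def firstVec (F : Type*) [Field F] : Fin 2 → F := ![1, 0]

theorem firstVec_ne_zero : firstVec F ≠ 0 := by simp [firstVec]

theorem det_GL_ne_zero (A : GL (Fin 2) F) : (A : Matrix (Fin 2) (Fin 2) F).det ≠ 0 :=
  ((isUnit_iff_isUnit_det _).1 A.isUnit).ne_zero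

theorem det_GL_entries_ne_zero (A : GL (Fin 2) F) :
    A.1 0 0 * A.1 1 1 - A.1 0 1 * A.1 1 0 ≠ 0 := by
  have := det_GL_ne_zero A
  rwa [det_fin_two] at this

/-- Division of an invertible matrix by its determinant. -/
def detTwist (A : GL (Fin 2) F) : GL (Fin 2) F :=
  GeneralLinearGroup.mkOfDetNeZero ((A.1.det)⁻¹ • A.1) (by
    have := det_GL_ne_zero A
    simp [this])

theorem detTwist_val (A : GL (Fin 2) F) : (detTwist A).1 = (A.1.det)⁻¹ • A.1 := rfl

theorem detTwist_apply (A : GL (Fin 2) F) (i j : Fin 2) :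
    (detTwist A).1 i j = (A.1.det)⁻¹ * A.1 i j := rfl

theorem det_detTwist (A : GL (Fin 2) F) : (detTwist A).1.det = (A.1.det)⁻¹ := by
  have := det_GL_ne_zero A
  rw [detTwist_val, det_smul]
  simp
  field_simp

/-- In size 2, scaling by the inverse determinant inverts the determinant, so a second application
undoes the first. -/
theorem detTwist_involutive : Function.Involutive (detTwist (F := F)) := by
  intro A
  have := det_GL_ne_zero A
  apply Units.ext
  rw [detTwist_val, det_detTwist, detTwist_val, smul_smul]
  simp [this]

/-- The invertible matrices sending `u` to `w`. -/
def vertFix (u w : Fin 2 → F) : Set (GL (Fin 2) F) := {A | A.1 *ᵥ u = w}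

/-- The invertible matrices `A` with `A u = det A • w`; equivalently, the transpose of `A` sends
one vector determined by `w` to one determined by `u`. -/
def horFix (u w : Fin 2 → F) : Set (GL (Fin 2) F) := {A | A.1 *ᵥ u = A.1.det • w}

theorem horFix_eq_preimage (u w : Fin 2 → F) : horFix u w = detTwist ⁻¹' vertFix u w := by
  ext A
  have := det_GL_ne_zero A
  simp only [horFix, vertFix, Set.mem_ofPred_eq, Set.mem_preimage, detTwist_val, smul_mulVec]
  rw [inv_smul_eq_iff₀ this]

theorem exists_GL_val_eq {a b c d : F} (h : a * d - b * c ≠ 0) :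
    ∃ A : GL (Fin 2) F, A.1 = !![a, b; c, d] :=
  ⟨GeneralLinearGroup.mkOfDetNeZero !![a, b; c, d] (by simpa [det_fin_two] using h), rfl⟩

theorem exists_GL_mulVec_eq_firstVec {u : Fin 2 → F} (hu : u ≠ 0) :
    ∃ g : GL (Fin 2) F, g.1 *ᵥ u = firstVec F := by
  by_cases h0 : u 0 = 0
  · have h1 : u 1 ≠ 0 := by
      rcases (fin_two_ne_zero_iff u).1 hu with h | h
      · exact absurd h0 h
      · exact h
    obtain ⟨g, hg⟩ := exists_GL_val_eq (a := 0) (b := (u 1)⁻¹) (c := 1) (d := 0) (by simp [h1])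
    refine ⟨g, ?_⟩
    rw [mulVec_fin_two_eq_iff, hg]
    simp [firstVec, h0, h1]
  · obtain ⟨g, hg⟩ := exists_GL_val_eq (a := (u 0)⁻¹) (b := 0) (c := -u 1 / u 0) (d := 1)
      (by simp [h0])
    refine ⟨g, ?_⟩
    rw [mulVec_fin_two_eq_iff, hg]
    simp [firstVec, h0]

theorem upperTri_val (x : Fˣ) (z : F) (y : Fˣ) :
    (upperTri x z y).1 = !![(x : F), z; 0, (y : F)] := rfl

theorem mem_vertFix_firstVec {A : GL (Fin 2) F} {w : Fin 2 → F} :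
    A ∈ vertFix (firstVec F) w ↔ A.1 0 0 = w 0 ∧ A.1 1 0 = w 1 := by
  rw [vertFix, Set.mem_ofPred_eq, mulVec_fin_two_eq_iff]
  simp [firstVec]

theorem exists_eq_upperTri {A : GL (Fin 2) F} (h : A.1 1 0 = 0) :
    ∃ (x : Fˣ) (z : F) (y : Fˣ), A = upperTri x z y := by
  have hd := det_GL_entries_ne_zero A
  rw [h, mul_zero, sub_zero] at hd
  refine ⟨Units.mk0 (A.1 0 0) (left_ne_zero_of_mul hd), A.1 0 1,
    Units.mk0 (A.1 1 1) (right_ne_zero_of_mul hd), ?_⟩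
  apply Units.ext
  rw [upperTri_val]
  ext i j
  fin_cases i <;> fin_cases j <;> simp [h]

theorem vertFix_firstVec_eq_range :
    vertFix (firstVec F) (firstVec F) =
      Set.range (fun zy : F × Fˣ => upperTri 1 zy.1 zy.2) := by
  ext A
  rw [mem_vertFix_firstVec]
  constructor
  · rintro ⟨h0, h1⟩
    obtain ⟨x, z, y, rfl⟩ := exists_eq_upperTri (A := A) (by simpa [firstVec] using h1)
    refine ⟨(z, y), ?_⟩
    have : x = 1 := by
      ext
      simpa [upperTri_val, firstVec] using h0
    rw [this]
  · rintro ⟨⟨z, y⟩, rfl⟩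
    simp [upperTri_val, firstVec]

theorem ncard_vertFix_firstVec [Fintype F] :
    (vertFix (firstVec F) (firstVec F)).ncard = Fintype.card F * (Fintype.card F - 1) := by
  classical
  rw [vertFix_firstVec_eq_range, ← Set.image_univ, Set.ncard_image_of_injective, Set.ncard_univ,
    Nat.card_prod, Nat.card_eq_fintype_card, Nat.card_eq_fintype_card, Fintype.card_units]
  rintro ⟨z, y⟩ ⟨z', y'⟩ h
  have h' := congrArg Units.val h
  simp only [upperTri_val] at h'
  have h1 := congrFun (congrFun h' 0) 1
  have h2 := congrFun (congrFun h' 1) 1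
  simp at h1 h2
  simp [h1, Units.ext h2]

theorem ncard_vertFix [Fintype F] {u w : Fin 2 → F} (hu : u ≠ 0) (hw : w ≠ 0) :
    (vertFix u w).ncard = Fintype.card F * (Fintype.card F - 1) := by
  obtain ⟨g, hg⟩ := exists_GL_mulVec_eq_firstVec hu
  obtain ⟨h, hh⟩ := exists_GL_mulVec_eq_firstVec hw
  have hg' : (g⁻¹).1 *ᵥ firstVec F = u := by
    rw [← hg, mulVec_mulVec, ← Units.val_mul]; simp
  have hh' : (h⁻¹).1 *ᵥ firstVec F = w := by
    rw [← hh, mulVec_mulVec, ← Units.val_mul]; simp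
  rw [← ncard_vertFix_firstVec,
    ← Set.ncard_image_of_injective (vertFix u w) (f := fun A => h * A * g⁻¹)
      (fun A B hAB => by simpa using hAB)]
  congr 1
  ext A
  simp only [Set.mem_image, vertFix, Set.mem_ofPred_eq]
  constructor
  · rintro ⟨B, hB, rfl⟩
    rw [Units.val_mul, Units.val_mul, ← mulVec_mulVec, ← mulVec_mulVec, hg', hB, hh]
  · intro hA
    refine ⟨h⁻¹ * A * g, ?_, by group⟩
    rw [Units.val_mul, Units.val_mul, ← mulVec_mulVec, ← mulVec_mulVec, hg, hA, hh']

theorem ncard_horFix [Fintype F] {u w : Fin 2 → F} (hu : u ≠ 0) (hw : w ≠ 0) :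
    (horFix u w).ncard = Fintype.card F * (Fintype.card F - 1) := by
  rw [← ncard_vertFix hu hw, horFix_eq_preimage, ← detTwist_involutive.image_eq_preimage_symm,
    Set.ncard_image_of_injective _ detTwist_involutive.injective]

end Coordinates

/-! ### Matrices with singular differences, and agreement under the determinant twist. -/

section Cliques

variable {F : Type*} [Field F]

theorem vecMul_fin_two_eq_iff (A : Matrix (Fin 2) (Fin 2) F) (x y : Fin 2 → F) :
    x ᵥ* A = y ↔ x 0 * A 0 0 + x 1 * A 1 0 = y 0 ∧ x 0 * A 0 1 + x 1 * A 1 1 = y 1 := by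
  simp [funext_iff, Fin.forall_fin_two, vecMul, dotProduct]

/-- The image of a singular `2 × 2` matrix is spanned by any of its nonzero elements. -/
theorem vecMul_eq_zero_of_det_eq_zero {D : Matrix (Fin 2) (Fin 2) F} {u x : Fin 2 → F}
    (hD : D.det = 0) (hu : D *ᵥ u ≠ 0) (hx : x ⬝ᵥ D *ᵥ u = 0) : x ᵥ* D = 0 := by
  rw [det_fin_two] at hD
  have hu' := (fin_two_ne_zero_iff _).1 hu
  simp only [dotProduct, mulVec, Fin.sum_univ_two] at hu' hx
  rw [vecMul_fin_two_eq_iff]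
  simp only [Pi.zero_apply]
  rcases hu' with h | h
  · constructor <;> refine (mul_eq_zero.1 ?_).resolve_left h
    · linear_combination (D 0 0) * hx - (x 1 * u 1) * hD
    · linear_combination (D 0 1) * hx + (x 1 * u 0) * hD
  · constructor <;> refine (mul_eq_zero.1 ?_).resolve_left h
    · linear_combination (D 1 0) * hx + (x 0 * u 1) * hD
    · linear_combination (D 1 1) * hx - (x 0 * u 0) * hD

theorem exists_rank_one_of_det_eq_zero {M : Matrix (Fin 2) (Fin 2) F} (hM : M.det = 0)
    (h0 : M ≠ 0) : ∃ s t : Fin 2 → F, s ≠ 0 ∧ t ≠ 0 ∧ ∀ i j, M i j = s i * t j := by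
  rw [det_fin_two] at hM
  by_cases hr : M 0 = 0
  · refine ⟨![0, 1], M 1, by simp, fun h => h0 ?_, ?_⟩
    · ext i j
      fin_cases i
      · exact congrFun hr j
      · exact congrFun h j
    · intro i j
      fin_cases i
      · simpa using congrFun hr j
      · simp
  · rcases (fin_two_ne_zero_iff _).1 hr with h | h
    · refine ⟨![1, M 1 0 / M 0 0], M 0, by simp, hr, ?_⟩
      intro i j
      fin_cases i <;> fin_cases j <;> simp <;> field_simp
      linear_combination hM
    · refine ⟨![1, M 1 1 / M 0 1], M 0, by simp, hr, ?_⟩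
      intro i j
      fin_cases i <;> fin_cases j <;> simp <;> field_simp
      linear_combination -hM

/-- A set of invertible matrices with singular differences lies in a single `vertFix` or
`horFix`. -/
theorem subset_vertFix_or_horFix {B : Set (GL (Fin 2) F)}
    (hB : ∀ M ∈ B, ∀ N ∈ B, (M.1 - N.1).det = 0) :
    ∃ u w : Fin 2 → F, u ≠ 0 ∧ w ≠ 0 ∧ (B ⊆ vertFix u w ∨ B ⊆ horFix u w) := by
  rcases B.eq_empty_or_nonempty with rfl | ⟨B₀, hB₀⟩
  · exact ⟨firstVec F, firstVec F, firstVec_ne_zero, firstVec_ne_zero, by simp⟩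
  have hmul : ∀ u : Fin 2 → F, u ≠ 0 → B₀.1 *ᵥ u ≠ 0 := by
    intro u hu h
    have := eq_zero_of_mulVec_eq_zero (det_GL_ne_zero B₀) h
    exact hu this
  by_cases hall : ∀ M ∈ B, M = B₀
  · refine ⟨firstVec F, _, firstVec_ne_zero, hmul _ firstVec_ne_zero, Or.inl ?_⟩
    intro M hM
    rw [hall M hM]
    rfl
  push Not at hall
  obtain ⟨B₁, hB₁, hne⟩ := hall
  obtain ⟨s, t, hs, ht, hst⟩ := exists_rank_one_of_det_eq_zero (hB B₁ hB₁ B₀ hB₀)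
    (fun h => hne (Units.ext (sub_eq_zero.1 h)))
  have hst00 := hst 0 0
  have hst01 := hst 0 1
  have hst10 := hst 1 0
  have hst11 := hst 1 1
  simp only [Matrix.sub_apply] at hst00 hst01 hst10 hst11
  -- `u` spans the kernel of the rank-one difference of `B₁` and `B₀`, and `x` annihilates its
  -- image.
  let u : Fin 2 → F := ![t 1, - t 0]
  let x : Fin 2 → F := ![s 1, - s 0]
  have hu : u ≠ 0 := by
    rw [fin_two_ne_zero_iff] at ht ⊢
    simpa [u, or_comm] using ht
  have hx : x ≠ 0 := by
    rw [fin_two_ne_zero_iff] at hs ⊢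
    simpa [x, or_comm] using hs
  -- Polarization of the determinant: for `D = N - B₀`, the matrices `D`, `s tᵀ` and `D - s tᵀ` are
  -- all singular, so the mixed term, which is `x ⬝ᵥ D *ᵥ u`, vanishes.
  have hpair : ∀ N ∈ B, x ⬝ᵥ (N.1 - B₀.1) *ᵥ u = 0 := by
    intro N hN
    have h1 := hB N hN B₁ hB₁
    have h2 := hB N hN B₀ hB₀
    have h3 := hB B₁ hB₁ B₀ hB₀
    rw [det_fin_two] at h1 h2 h3
    simp only [Matrix.sub_apply] at h1 h2 h3
    simp only [dotProduct, mulVec, Fin.sum_univ_two, Matrix.sub_apply, u, x, cons_val_zero, cons_val_one]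
    linear_combination h2 + h3 - h1 - (N.1 1 1 - B₀.1 1 1) * hst00 + (N.1 1 0 - B₀.1 1 0) * hst01
      + (N.1 0 1 - B₀.1 0 1) * hst10 - (N.1 0 0 - B₀.1 0 0) * hst11
  by_cases hvert : ∀ N ∈ B, (N.1 - B₀.1) *ᵥ u = 0
  · refine ⟨u, _, hu, hmul u hu, Or.inl fun N hN => ?_⟩
    have := hvert N hN
    rw [sub_mulVec, sub_eq_zero] at this
    exact this
  push Not at hvert
  obtain ⟨N, hN, hNu⟩ := hvert
  have hNx := vecMul_eq_zero_of_det_eq_zero (hB N hN B₀ hB₀) hNu (hpair N hN)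
  -- Once one `N` moves `u` differently from `B₀`, all differences are annihilated by `x`. If `N'`
  -- acts on `u` as `B₀` does, then `N - N'` still moves `u`, and comparing with `N` settles this
  -- case.
  have hhor : ∀ N' ∈ B, x ᵥ* (N'.1 - B₀.1) = 0 := by
    intro N' hN'
    by_cases hN'u : (N'.1 - B₀.1) *ᵥ u = 0
    · have hdiff : (N.1 - N'.1) *ᵥ u = (N.1 - B₀.1) *ᵥ u := by
        rw [← sub_zero ((N.1 - B₀.1) *ᵥ u), ← hN'u, ← sub_mulVec]
        congr 1
        abel
      have := vecMul_eq_zero_of_det_eq_zero (hB N hN N' hN') (u := u) (x := x)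
        (by rwa [hdiff]) (by rw [hdiff]; exact hpair N hN)
      rw [show N'.1 - B₀.1 = (N.1 - B₀.1) - (N.1 - N'.1) by abel, vecMul_sub, this, hNx, sub_zero]
    · exact vecMul_eq_zero_of_det_eq_zero (hB N' hN' B₀ hB₀) hN'u (hpair N' hN')
  -- The common row condition `x ᵥ* A = y` becomes a `horFix` condition through the cofactor
  -- identities.
  let y : Fin 2 → F := x ᵥ* B₀.1
  have hy : y ≠ 0 := fun h => hx (eq_zero_of_vecMul_eq_zero (det_GL_ne_zero B₀) h)
  refine ⟨![y 1, - y 0], ![x 1, - x 0], ?_, ?_, Or.inr fun A hA => ?_⟩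
  · rw [fin_two_ne_zero_iff] at hy ⊢
    simpa [or_comm] using hy
  · rw [fin_two_ne_zero_iff] at hx ⊢
    simpa [or_comm] using hx
  · have h := hhor A hA
    rw [vecMul_sub, sub_eq_zero] at h
    obtain ⟨h0, h1⟩ := (vecMul_fin_two_eq_iff A.1 x y).1 h
    rw [horFix, Set.mem_ofPred_eq, mulVec_fin_two_eq_iff, det_fin_two]
    simp only [cons_val_zero, cons_val_one, Pi.smul_apply, smul_eq_mul]
    constructor
    · linear_combination (A.1 0 1) * h0 - (A.1 0 0) * h1
    · linear_combination (A.1 1 1) * h0 - (A.1 1 0) * h1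

/-- Without a common point, the additive map `f v = A σ(v) - B τ(v)` is injective, hence bijective
by finiteness. Let `m` be the common value of the twisted maps at `w`. Since `m = A σ(w) / det A`,
the determinant of the pair `m`, `A σ(v)` is `σ` of that of `w`, `v`, and likewise for `B`, `τ`. So
surjectivity of `f` makes `σ - τ` surjective on `F`, although it kills 1. -/
theorem exists_agree_detTwist [Fintype F] {σ τ : RingAut F} {A B : GL (Fin 2) F}
    (h : ∃ v : Fin 2 → F, v ≠ 0 ∧
      (detTwist A).1 *ᵥ (fun i => σ (v i)) = (detTwist B).1 *ᵥ (fun i => τ (v i))) :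
    ∃ v : Fin 2 → F, v ≠ 0 ∧ A.1 *ᵥ (fun i => σ (v i)) = B.1 *ᵥ (fun i => τ (v i)) := by
  obtain ⟨w, hw, hAB⟩ := h
  by_contra! H
  let f : (Fin 2 → F) →+ (Fin 2 → F) :=
    { toFun := fun v => A.1 *ᵥ (fun i => σ (v i)) - B.1 *ᵥ (fun i => τ (v i))
      map_zero' := by ext i; fin_cases i <;> simp
      map_add' := by
        intro v v'
        ext i
        fin_cases i <;> simp <;> ring }
  have hinj : Function.Injective f := by
    rw [injective_iff_map_eq_zero]
    intro v hv
    by_contra hv0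
    exact H v hv0 (sub_eq_zero.1 hv)
  have hsurj := Finite.surjective_of_injective hinj
  set m := (detTwist A).1 *ᵥ (fun i => σ (w i)) with hm
  have hm0 : m ≠ 0 := mulVec_comp_ne_zero (detTwist A) σ hw
  obtain ⟨hA0, hA1⟩ := (mulVec_fin_two_eq_iff _ _ _).1 hm.symm
  obtain ⟨hB0, hB1⟩ := (mulVec_fin_two_eq_iff _ _ _).1 hAB.symm
  have hdA := det_GL_ne_zero A
  have hdB := det_GL_ne_zero B
  simp only [detTwist_apply] at hA0 hA1 hB0 hB1
  rw [det_fin_two] at hA0 hA1 hB0 hB1 hdA hdB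
  have key : ∀ v, m 0 * f v 1 - m 1 * f v 0 =
      σ (w 0 * v 1 - w 1 * v 0) - τ (w 0 * v 1 - w 1 * v 0) := by
    intro v
    have e0 : f v 0 = A.1 0 0 * σ (v 0) + A.1 0 1 * σ (v 1) -
        (B.1 0 0 * τ (v 0) + B.1 0 1 * τ (v 1)) := by simp [f]
    have e1 : f v 1 = A.1 1 0 * σ (v 0) + A.1 1 1 * σ (v 1) -
        (B.1 1 0 * τ (v 0) + B.1 1 1 * τ (v 1)) := by simp [f]
    have eA : m 0 * (A.1 1 0 * σ (v 0) + A.1 1 1 * σ (v 1)) -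
        m 1 * (A.1 0 0 * σ (v 0) + A.1 0 1 * σ (v 1)) = σ (w 0 * v 1 - w 1 * v 0) := by
      rw [← hA0, ← hA1]
      simp only [map_sub, map_mul]
      field_simp
      ring
    have eB : m 0 * (B.1 1 0 * τ (v 0) + B.1 1 1 * τ (v 1)) -
        m 1 * (B.1 0 0 * τ (v 0) + B.1 0 1 * τ (v 1)) = τ (w 0 * v 1 - w 1 * v 0) := by
      rw [← hB0, ← hB1]
      simp only [map_sub, map_mul]
      field_simp
      ring
    rw [e0, e1, ← eA, ← eB]
    ring
  have hsurj' : Function.Surjective (fun d : F => σ d - τ d) := by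
    intro y
    obtain ⟨n, hn⟩ : ∃ n : Fin 2 → F, m 0 * n 1 - m 1 * n 0 = y := by
      rcases (fin_two_ne_zero_iff m).1 hm0 with h | h
      · exact ⟨![0, y / m 0], by simp; field_simp⟩
      · exact ⟨![- y / m 1, 0], by simp; field_simp⟩
    obtain ⟨v, rfl⟩ := hsurj n
    exact ⟨_, (key v).symm.trans hn⟩
  have := Finite.injective_iff_surjective.2 hsurj' (a₁ := 1) (a₂ := 0) (by simp)
  exact one_ne_zero this

end Cliques

/-! ### Semilinear maps without nonzero fixed vectors. -/

section SemilinearFixedPoints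

variable {F : Type*} [Field F]

/-- The semilinear map with matrix `!![a, b; c, d]` and automorphism `σ` fixes only zero. -/
def FixesOnlyZero (σ : RingAut F) (a b c d : F) : Prop :=
  ∀ x y : F, a * σ x + b * σ y = x → c * σ x + d * σ y = y → x = 0 ∧ y = 0

theorem fixesOnlyZero_upper {σ : RingAut F} {a d : F} (ha : NotRatio σ a) (hd : NotRatio σ d)
    (b : F) : FixesOnlyZero σ a b 0 d := by
  intro x y hx hy
  have hy0 := hd y (by linear_combination hy)
  subst hy0
  exact ⟨ha x (by simpa using hx), rfl⟩

theorem fixesOnlyZero_lower {σ : RingAut F} {a d : F} (ha : NotRatio σ a) (hd : NotRatio σ d)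
    (c : F) : FixesOnlyZero σ a 0 c d := by
  intro x y hx hy
  have hx0 := ha x (by linear_combination hx)
  subst hx0
  exact ⟨rfl, hd y (by simpa using hy)⟩

/-- In the coordinates `x - s * y` and `y` the map is antidiagonal with entries `b` and `c`, and a
fixed vector gives a solution of the equation in `h`. -/
theorem fixesOnlyZero_antidiagonal_conj {σ : RingAut F} {b c : F}
    (h : ∀ t, b * σ (c * σ t) = t → t = 0) (s : F) :
    FixesOnlyZero σ (s * c) (b - c * s * σ s) c (-(c * σ s)) := by
  intro x y hx hy
  have hy' : c * σ (x - s * y) = y := by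
    rw [map_sub, map_mul]
    linear_combination hy
  have ht : x - s * y = 0 := h _ (by
    rw [hy']
    linear_combination hx - s * hy)
  rw [ht] at hy'
  have hy0 : y = 0 := by rw [← hy']; simp
  exact ⟨by simpa [hy0] using ht, hy0⟩

/-- In the coordinates `(1 + r) * x - y` and `y - r * x` the map is diagonal with entries `a` and
`d`. The coordinate change has determinant 1, so the matrix keeps determinant `a * d` while its
lower right entry varies with `r`. -/
theorem fixesOnlyZero_diagonal_conj {σ : RingAut F} {a d : F} (ha : NotRatio σ a)
    (hd : NotRatio σ d) (r : F) :
    FixesOnlyZero σ (a * (1 + σ r) - d * σ r) (d - a)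
      (a * r * (1 + σ r) - d * (1 + r) * σ r) (d * (1 + r) - a * r) := by
  intro x y hx hy
  have h1 := ha ((1 + r) * x - y) (by
    simp only [map_sub, map_mul, map_add, map_one]
    linear_combination (1 + r) * hx - hy)
  have h2 := hd (y - r * x) (by
    simp only [map_sub, map_mul]
    linear_combination hy - r * hx)
  have hx0 : x = 0 := by linear_combination h1 + h2
  exact ⟨hx0, by simpa [hx0] using h2⟩

/-- If every element of `T σ` agrees somewhere with every matrix fixing the first basis vector,
then `T` consists of the matrices with a given eigenvalue at the first basis vector. -/
theorem exists_unit_eq_vertFix_of_agree [Finite F] (h2 : (2 : F) ≠ 0) {σ : RingAut F}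
    (hσ : σ ≠ 1) {u w : Fin 2 → F} (hu : u ≠ 0) (hw : w ≠ 0) {T : Set (GL (Fin 2) F)}
    (hT : T = vertFix u w ∨ T = horFix u w)
    (h : ∀ A ∈ vertFix (firstVec F) (firstVec F), ∀ B ∈ T,
      ∃ v : Fin 2 → F, v ≠ 0 ∧ A.1 *ᵥ v = B.1 *ᵥ (fun i => σ (v i))) :
    ∃ a : Fˣ, T = vertFix (firstVec F) ![(a : F), 0] := by
  obtain ⟨a, d, ha0, hd0, had, ha, hd⟩ := exists_pair_notRatio h2 hσ
  -- The matrix of `B` is `upperTri 1 z y` times `M = !![a, b; c, d]`. Agreement with `upperTri 1 z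
  -- y` therefore means that `M σ` fixes a vector, so no such `B` lies in `T`.
  have key : ∀ z y a b c d : F, y ≠ 0 → a * d - b * c ≠ 0 → FixesOnlyZero σ a b c d →
      (∀ B : GL (Fin 2) F, B.1 = !![a + z * c, b + z * d; y * c, y * d] → B ∈ T) → False := by
    intro z y a b c d hy hdet hfix hB
    obtain ⟨B, hBv⟩ := exists_GL_val_eq (a := a + z * c) (b := b + z * d) (c := y * c)
      (d := y * d) (by
        rw [show (a + z * c) * (y * d) - (b + z * d) * (y * c) = y * (a * d - b * c) by ring]
        exact mul_ne_zero hy hdet)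
    obtain ⟨v, hv, hAB⟩ := h (upperTri 1 z (Units.mk0 y hy))
      (by rw [mem_vertFix_firstVec]; simp [upperTri_val, firstVec]) B (hB B hBv)
    rw [hBv, mulVec_fin_two_eq_iff, upperTri_val] at hAB
    simp [vecHead, vecTail] at hAB
    obtain ⟨h0, h1⟩ := hAB
    have h1' : c * σ (v 0) + d * σ (v 1) = v 1 := by
      apply mul_left_cancel₀ hy
      linear_combination -h1
    obtain ⟨hv0, hv1⟩ := hfix (v 0) (v 1) (by linear_combination -h0 - z * h1') h1'
    exact hv (by ext i; fin_cases i <;> simp [hv0, hv1])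
  rw [fin_two_ne_zero_iff] at hu hw
  rcases hT with hT | hT
  · have key' : ∀ z y a b c d : F, y ≠ 0 → a * d - b * c ≠ 0 → FixesOnlyZero σ a b c d →
        (a * u 0 + b * u 1) + z * (c * u 0 + d * u 1) = w 0 →
        y * (c * u 0 + d * u 1) = w 1 → False := by
      intro z y a b c d hy hdet hfix h0 h1
      refine key z y a b c d hy hdet hfix fun B hB => ?_
      rw [hT, vertFix, Set.mem_ofPred_eq, mulVec_fin_two_eq_iff, hB]
      simp
      exact ⟨by linear_combination h0, by linear_combination h1⟩
    by_cases hw1 : w 1 = 0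
    · have hw0 := hw.resolve_right (not_not.2 hw1)
      by_cases hu1 : u 1 = 0
      · have hu0 := hu.resolve_right (not_not.2 hu1)
        refine ⟨Units.mk0 (w 0 / u 0) (div_ne_zero hw0 hu0), ?_⟩
        rw [hT]
        ext B
        rw [mem_vertFix_firstVec, vertFix, Set.mem_ofPred_eq, mulVec_fin_two_eq_iff]
        simp [hw1, hu1, hu0, eq_div_iff hu0]
      · exfalso
        obtain ⟨c, hc0, hc⟩ := exists_notRatio_sq h2 σ (div_ne_zero hw0 hu1)
        -- The shear parameter is chosen so that the second coordinate of the image of `u` vanishes,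
        -- as `w 1 = 0` demands.
        have hs : σ (σ.symm (u 0 / u 1)) = u 0 / u 1 := RingEquiv.apply_symm_apply _ _
        refine key' 0 1 _ _ _ _ one_ne_zero ?_
          (fixesOnlyZero_antidiagonal_conj hc (σ.symm (u 0 / u 1))) ?_ ?_
        · rw [show ∀ s b : F, s * c * -(c * σ s) - (b - c * s * σ s) * c = -(b * c) by
            intros; ring]
          exact neg_ne_zero.2 (mul_ne_zero (div_ne_zero hw0 hu1) hc0)
        · rw [hs]
          field_simp
          ring
        · rw [hs, hw1]
          field_simp
          ring
    · exfalso
      by_cases hu1 : u 1 = 0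
      · have hu0 := hu.resolve_right (not_not.2 hu1)
        refine key' ((w 0 - a * u 0) / u 0) (w 1 / u 0) a 0 1 d (div_ne_zero hw1 hu0)
          (by simp [ha0, hd0]) (fixesOnlyZero_lower ha hd 1) ?_ ?_
        · rw [hu1]; field_simp; ring
        · rw [hu1]; field_simp; ring
      · refine key' ((w 0 - a * u 0) / (d * u 1)) (w 1 / (d * u 1)) a 0 0 d
          (div_ne_zero hw1 (mul_ne_zero hd0 hu1))
          (by simp [ha0, hd0]) (fixesOnlyZero_upper ha hd 0) ?_ ?_
        · field_simp; ring
        · field_simp; ring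
  · exfalso
    -- In the horizontal case `y` scales both the second coordinate of `B u` and `det B`, so it
    -- cancels there: the second equation constrains `M` alone.
    have key' : ∀ z y a b c d : F, y ≠ 0 → a * d - b * c ≠ 0 → FixesOnlyZero σ a b c d →
        (a * u 0 + b * u 1) + z * (c * u 0 + d * u 1) = y * (a * d - b * c) * w 0 →
        c * u 0 + d * u 1 = (a * d - b * c) * w 1 → False := by
      intro z y a b c d hy hdet hfix h0 h1
      refine key z y a b c d hy hdet hfix fun B hB => ?_
      rw [hT, horFix, Set.mem_ofPred_eq, mulVec_fin_two_eq_iff, hB]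
      simp [det_fin_two]
      exact ⟨by linear_combination h0, by linear_combination y * h1⟩
    by_cases hw1 : w 1 = 0
    · have hw0 := hw.resolve_right (not_not.2 hw1)
      by_cases hu0 : u 0 = 0
      · have hu1 := hu.resolve_left (not_not.2 hu0)
        obtain ⟨c, hc0, hc⟩ := exists_notRatio_sq h2 σ (one_ne_zero (α := F))
        refine key' 0 (-u 1 / (c * w 0)) _ _ _ _
          (div_ne_zero (neg_ne_zero.2 hu1) (mul_ne_zero hc0 hw0)) ?_
          (fixesOnlyZero_antidiagonal_conj hc 0) ?_ ?_
        · simp [hc0]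
        · simp [hu0]; field_simp
        · simp [hu0, hw1]
      · refine key' 0 (u 0 / (d * w 0)) a 0 (-(d * u 1) / u 0) d
          (div_ne_zero hu0 (mul_ne_zero hd0 hw0))
          (by simp [ha0, hd0]) (fixesOnlyZero_lower ha hd _) ?_ ?_
        · field_simp; ring
        · rw [hw1]; field_simp; ring
    · by_cases hu0 : u 0 = 0
      · have hu1 := hu.resolve_left (not_not.2 hu0)
        have hda : d - a ≠ 0 := sub_ne_zero.2 had.symm
        -- With `u 0 = 0` a lower triangular `M` would need `a = u 1 / w 1`, which may fail
        -- `NotRatio`. The lower right entry of the conjugated diagonal map is affine in `r` with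
        -- slope `d - a ≠ 0`, so it takes the required value.
        obtain ⟨r, hr⟩ : ∃ r : F, (d * (1 + r) - a * r) * u 1 = a * d * w 1 :=
          ⟨(a * d * w 1 / u 1 - d) / (d - a), by field_simp; ring⟩
        have hdet : (a * (1 + σ r) - d * σ r) * (d * (1 + r) - a * r) -
            (d - a) * (a * r * (1 + σ r) - d * (1 + r) * σ r) = a * d := by ring
        refine key' ((a * d * w 0 - (d - a) * u 1) / (a * d * w 1)) 1 _ _ _ _ one_ne_zero ?_
          (fixesOnlyZero_diagonal_conj ha hd r) ?_ ?_
        · rw [hdet]; exact mul_ne_zero ha0 hd0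
        · rw [hdet, hu0, mul_zero, mul_zero, zero_add, zero_add, hr]
          field_simp
          ring
        · rw [hdet, hu0]
          linear_combination hr
      · refine key' ((a * d * w 0 - a * u 0) / (a * d * w 1)) 1 a 0
          ((a * d * w 1 - d * u 1) / u 0) d one_ne_zero
          (by simp [ha0, hd0]) (fixesOnlyZero_lower ha hd _) ?_ ?_
        · field_simp; ring
        · field_simp; ring

end SemilinearFixedPoints

/-! ### Intersecting sets of semilinear maps: fibers, the bound and the equality case. -/

section SemilinearGroup

variable {p : ℕ} [Fact p.Prime] {F : Type*} [Field F] [Fintype F] [CharP F p]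

theorem frob_pow_apply (j : ℕ) (x : F) : (frob p F ^ j) x = x ^ p ^ j := by
  induction j with
  | zero => simp
  | succ j ih =>
    rw [pow_succ', RingAut.mul_apply, ih, pow_succ, pow_mul]
    rfl

theorem orderOf_frob {k : ℕ} (hk : 1 ≤ k) (hF : Fintype.card F = p ^ k) :
    orderOf (frob p F) = k := by
  classical
  have hp := (Fact.out : p.Prime).one_lt
  rw [orderOf_eq_iff hk]
  constructor
  · ext x
    rw [frob_pow_apply, ← hF, FiniteField.pow_card]
    rfl
  · intro m hm hm0 h
    obtain ⟨ω, hω⟩ := IsCyclic.exists_generator (α := Fˣ)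
    have hord : orderOf ω = p ^ k - 1 := by
      rw [orderOf_eq_card_of_forall_mem_zpowers hω, Nat.card_eq_fintype_card,
        Fintype.card_units, hF]
    have h1 : ω ^ p ^ m = ω ^ 1 := by
      ext
      have := DFunLike.congr_fun h (ω : F)
      rw [frob_pow_apply] at this
      simpa using this
    have h2 : 1 < p ^ m := Nat.one_lt_pow hm0.ne' hp
    have h3 : p ^ m < p ^ k := Nat.pow_lt_pow_right hp hm
    rw [pow_eq_pow_iff_modEq, hord] at h1
    have h4 := (Nat.modEq_iff_dvd' h2.le).1 h1.symm
    have := Nat.le_of_dvd (by omega) h4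
    omega

theorem card_zpowers_frob {k : ℕ} (hk : 1 ≤ k) (hF : Fintype.card F = p ^ k) :
    Nat.card (Subgroup.zpowers (frob p F)) = k := by
  rw [Nat.card_zpowers, orderOf_frob hk hF]

theorem isIntersecting_iff (S : Set (GammaL p F)) :
    IsIntersecting (NonzeroVec F) S ↔ ∀ g ∈ S, ∀ h ∈ S, ∃ v : Fin 2 → F, v ≠ 0 ∧
      g.left.1 *ᵥ (fun i => g.right.1 (v i)) = h.left.1 *ᵥ (fun i => h.right.1 (v i)) := by
  constructor
  · intro H g hg h hh
    obtain ⟨v, hv⟩ := H g hg h hh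
    exact ⟨v.1, v.2, congrArg Subtype.val hv⟩
  · intro H g hg h hh
    obtain ⟨v, hv, hgh⟩ := H g hg h hh
    exact ⟨⟨v, hv⟩, Subtype.ext hgh⟩

/-- The matrices `A` with `A σ ∈ S`. -/
def fiber (S : Set (GammaL p F)) (σ : Subgroup.zpowers (frob p F)) : Set (GL (Fin 2) F) :=
  {A | (⟨A, σ⟩ : GammaL p F) ∈ S}

instance {K : Type*} [Field K] [Finite K] : Finite (RingAut K) := DFunLike.finite _

instance : Finite (GammaL p F) := Finite.of_equiv _ SemidirectProduct.equivProd.symm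

theorem ncard_eq_sum_fiber [Fintype (Subgroup.zpowers (frob p F))] (S : Set (GammaL p F)) :
    S.ncard = ∑ σ, (fiber S σ).ncard := by
  let e : S ≃ Σ σ, fiber S σ :=
    { toFun := fun g => ⟨g.1.right, g.1.left, g.2⟩
      invFun := fun x => ⟨⟨x.2.1, x.1⟩, x.2.2⟩ }
  rw [← Nat.card_coe_set_eq, Nat.card_congr e, Nat.card_sigma]
  rfl

theorem ncard_eq_of_fibers {k : ℕ} (hk : 1 ≤ k) (hF : Fintype.card F = p ^ k)
    {S : Set (GammaL p F)} (h : ∀ σ, (fiber S σ).ncard = p ^ k * (p ^ k - 1)) :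
    S.ncard = k * p ^ k * (p ^ k - 1) := by
  have := Fintype.ofFinite (Subgroup.zpowers (frob p F))
  rw [ncard_eq_sum_fiber, Finset.sum_congr rfl (fun σ _ => h σ), Finset.sum_const,
    Finset.card_univ, ← Nat.card_eq_fintype_card, card_zpowers_frob hk hF, smul_eq_mul, mul_assoc]

/-- If `M σ` and `N σ` agree at `v`, then `σ v` is a nonzero kernel vector of `M - N`. -/
theorem IsIntersecting.exists_fiber_subset {S : Set (GammaL p F)}
    (hS : IsIntersecting (NonzeroVec F) S) (σ : Subgroup.zpowers (frob p F)) :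
    ∃ u w : Fin 2 → F, u ≠ 0 ∧ w ≠ 0 ∧ (fiber S σ ⊆ vertFix u w ∨ fiber S σ ⊆ horFix u w) := by
  apply subset_vertFix_or_horFix
  intro M hM N hN
  obtain ⟨v, hv, hMN⟩ := (isIntersecting_iff S).1 hS _ hM _ hN
  rw [← exists_mulVec_eq_zero_iff]
  refine ⟨fun i => σ.1 (v i), fun h => hv ?_, ?_⟩
  · ext i
    simpa using congrFun h i
  · rw [sub_mulVec, sub_eq_zero]
    exact hMN

theorem IsIntersecting.ncard_fiber_le {S : Set (GammaL p F)}
    (hS : IsIntersecting (NonzeroVec F) S) (σ : Subgroup.zpowers (frob p F)) :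
    (fiber S σ).ncard ≤ Fintype.card F * (Fintype.card F - 1) := by
  obtain ⟨u, w, hu, hw, h | h⟩ := hS.exists_fiber_subset σ
  · exact (Set.ncard_le_ncard h).trans_eq (ncard_vertFix hu hw)
  · exact (Set.ncard_le_ncard h).trans_eq (ncard_horFix hu hw)

theorem IsIntersecting.ncard_le {k : ℕ} (hk : 1 ≤ k) (hF : Fintype.card F = p ^ k)
    {S : Set (GammaL p F)} (hS : IsIntersecting (NonzeroVec F) S) :
    S.ncard ≤ k * p ^ k * (p ^ k - 1) := by
  have := Fintype.ofFinite (Subgroup.zpowers (frob p F))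
  rw [ncard_eq_sum_fiber]
  refine (Finset.sum_le_card_nsmul _ _ _ fun σ _ => hS.ncard_fiber_le σ).trans_eq ?_
  rw [Finset.card_univ, ← Nat.card_eq_fintype_card, card_zpowers_frob hk hF, smul_eq_mul, hF,
    mul_assoc]

/-- A total equal to the sum of the fiberwise bounds forces equality in each fiber. -/
theorem IsIntersecting.exists_fiber_eq {k : ℕ} (hk : 1 ≤ k) (hF : Fintype.card F = p ^ k)
    {S : Set (GammaL p F)} (hS : IsIntersecting (NonzeroVec F) S)
    (hcard : S.ncard = k * p ^ k * (p ^ k - 1)) (σ : Subgroup.zpowers (frob p F)) :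
    ∃ u w : Fin 2 → F, u ≠ 0 ∧ w ≠ 0 ∧ (fiber S σ = vertFix u w ∨ fiber S σ = horFix u w) := by
  have := Fintype.ofFinite (Subgroup.zpowers (frob p F))
  have hle := fun σ => hS.ncard_fiber_le σ
  have hsum : ∑ σ, (fiber S σ).ncard =
      ∑ _σ : Subgroup.zpowers (frob p F), Fintype.card F * (Fintype.card F - 1) := by
    rw [← ncard_eq_sum_fiber, hcard, Finset.sum_const, Finset.card_univ,
      ← Nat.card_eq_fintype_card, card_zpowers_frob hk hF, smul_eq_mul, hF, mul_assoc]
  have heq := (Finset.sum_eq_sum_iff_of_le fun σ _ => hle σ).1 hsum σ (Finset.mem_univ σ)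
  obtain ⟨u, w, hu, hw, h | h⟩ := hS.exists_fiber_subset σ
  · exact ⟨u, w, hu, hw, Or.inl (Set.eq_of_subset_of_ncard_le h
      ((ncard_vertFix hu hw).trans heq.symm).le)⟩
  · exact ⟨u, w, hu, hw, Or.inr (Set.eq_of_subset_of_ncard_le h
      ((ncard_horFix hu hw).trans heq.symm).le)⟩

theorem card_stabilizer_nonzeroVec {k : ℕ} (hk : 1 ≤ k) (hF : Fintype.card F = p ^ k)
    (v : NonzeroVec F) :
    Nat.card (MulAction.stabilizer (GammaL p F) v) = k * p ^ k * (p ^ k - 1) := by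
  change Nat.card ((MulAction.stabilizer (GammaL p F) v : Set (GammaL p F)) : Type _) = _
  rw [Nat.card_coe_set_eq]
  refine ncard_eq_of_fibers hk hF fun σ => ?_
  have : fiber (MulAction.stabilizer (GammaL p F) v : Set (GammaL p F)) σ =
      vertFix (fun i => σ.1 (v.1 i)) v.1 := by
    ext A
    exact Subtype.ext_iff
  rw [this, ncard_vertFix ?_ v.2, hF]
  intro h
  apply v.2
  ext i
  simpa using congrFun h i

/-- Division of the matrix part of a semilinear map by its determinant. -/
def semilinearTwist (g : GammaL p F) : GammaL p F := ⟨detTwist g.left, g.right⟩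

theorem semilinearTwist_involutive : Function.Involutive (semilinearTwist (p := p) (F := F)) := by
  intro g
  exact SemidirectProduct.ext (detTwist_involutive g.left) rfl

theorem IsIntersecting.preimage_semilinearTwist {S : Set (GammaL p F)}
    (hS : IsIntersecting (NonzeroVec F) S) :
    IsIntersecting (NonzeroVec F) (semilinearTwist ⁻¹' S) := by
  rw [isIntersecting_iff] at hS ⊢
  intro g hg h hh
  exact exists_agree_detTwist (hS _ hg _ hh)

theorem ncard_preimage_semilinearTwist (S : Set (GammaL p F)) :
    (semilinearTwist ⁻¹' S).ncard = S.ncard := by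
  rw [← semilinearTwist_involutive.image_eq_preimage_symm,
    Set.ncard_image_of_injective _ semilinearTwist_involutive.injective]

/-- The semilinear maps for which the first basis vector is an eigenvector, with eigenvalue
determined by the automorphism. -/
def vertSet (a : Subgroup.zpowers (frob p F) → Fˣ) : Set (GammaL p F) :=
  {g | g.left.1 1 0 = 0 ∧ g.left.1 0 0 = a g.right}

/-- The semilinear maps preserving the line of the first basis vector, for which the eigenvalue on
the quotient is determined by the automorphism. -/
def horSet (d : Subgroup.zpowers (frob p F) → Fˣ) : Set (GammaL p F) :=
  {g | g.left.1 1 0 = 0 ∧ g.left.1 1 1 = d g.right}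

/-- Any two of the semilinear maps `c ↦ a σ * σ c` agree at some nonzero element. -/
def Compatible (a : Subgroup.zpowers (frob p F) → Fˣ) : Prop :=
  ∀ σ τ, ∃ c : F, c ≠ 0 ∧ a σ * σ.1 c = a τ * τ.1 c

theorem Compatible.inv {a : Subgroup.zpowers (frob p F) → Fˣ} (ha : Compatible a) :
    Compatible a⁻¹ := by
  intro σ τ
  obtain ⟨c, hc, h⟩ := ha σ τ
  refine ⟨c⁻¹, inv_ne_zero hc, ?_⟩
  simp only [Pi.inv_apply, Units.val_inv_eq_inv_val, map_inv₀, ← mul_inv, h]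

/-- For an upper triangular matrix, division by the determinant makes the upper left entry the
inverse of the old lower right one. -/
theorem horSet_eq_preimage (d : Subgroup.zpowers (frob p F) → Fˣ) :
    horSet d = semilinearTwist ⁻¹' vertSet d⁻¹ := by
  ext g
  have hdet := det_GL_ne_zero g.left
  simp only [horSet, vertSet, Set.mem_ofPred_eq, Set.mem_preimage, semilinearTwist,
    detTwist_apply, Pi.inv_apply, Units.val_inv_eq_inv_val]
  rw [mul_eq_zero, or_iff_right (inv_ne_zero hdet)]
  refine and_congr_right fun h => ?_
  rw [det_fin_two, h, mul_zero, sub_zero] at hdet ⊢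
  rw [mul_inv, mul_right_comm, inv_mul_cancel₀ (left_ne_zero_of_mul hdet), one_mul, _root_.inv_inj]

theorem fiber_vertSet (a : Subgroup.zpowers (frob p F) → Fˣ) (σ) :
    fiber (vertSet a) σ = vertFix (firstVec F) ![(a σ : F), 0] := by
  ext A
  rw [mem_vertFix_firstVec]
  exact and_comm

theorem ncard_vertSet {k : ℕ} (hk : 1 ≤ k) (hF : Fintype.card F = p ^ k)
    (a : Subgroup.zpowers (frob p F) → Fˣ) : (vertSet a).ncard = k * p ^ k * (p ^ k - 1) := by
  refine ncard_eq_of_fibers hk hF fun σ => ?_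
  rw [fiber_vertSet, ncard_vertFix firstVec_ne_zero (by simp), hF]

theorem ncard_horSet {k : ℕ} (hk : 1 ≤ k) (hF : Fintype.card F = p ^ k)
    (d : Subgroup.zpowers (frob p F) → Fˣ) : (horSet d).ncard = k * p ^ k * (p ^ k - 1) := by
  rw [horSet_eq_preimage, ncard_preimage_semilinearTwist, ncard_vertSet hk hF]

theorem Compatible.isIntersecting_vertSet {a : Subgroup.zpowers (frob p F) → Fˣ}
    (ha : Compatible a) : IsIntersecting (NonzeroVec F) (vertSet a) := by
  rw [isIntersecting_iff]
  rintro g ⟨hg0, hg⟩ h ⟨hh0, hh⟩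
  obtain ⟨c, hc, hcc⟩ := ha g.right h.right
  refine ⟨![c, 0], by simpa using hc, ?_⟩
  rw [mulVec_fin_two_eq_iff]
  simp [mulVec, dotProduct, hg0, hg, hh0, hh, hcc]

theorem Compatible.isIntersecting_horSet {d : Subgroup.zpowers (frob p F) → Fˣ}
    (hd : Compatible d) : IsIntersecting (NonzeroVec F) (horSet d) := by
  rw [horSet_eq_preimage]
  exact hd.inv.isIntersecting_vertSet.preimage_semilinearTwist

/-- Lower right entries 1 and `y` are chosen so that the second coordinates can agree only at zero;
the common point then lies on the line of the first basis vector. -/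
theorem compatible_of_isIntersecting_vertSet (h2 : (2 : F) ≠ 0)
    {a : Subgroup.zpowers (frob p F) → Fˣ} (ha : IsIntersecting (NonzeroVec F) (vertSet a)) :
    Compatible a := by
  intro σ τ
  obtain ⟨y, hy⟩ := exists_unit_forall_eq_zero h2 σ.1 τ.1
  obtain ⟨v, hv, hagree⟩ := (isIntersecting_iff _).1 ha ⟨upperTri (a σ) 0 1, σ⟩
    (by simp [vertSet, upperTri_val]) ⟨upperTri (a τ) 0 y, τ⟩ (by simp [vertSet, upperTri_val])
  rw [mulVec_fin_two_eq_iff] at hagree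
  simp [upperTri_val, vecHead, vecTail] at hagree
  have hv1 := hy (v 1) hagree.2.symm
  exact ⟨v 0, ((fin_two_ne_zero_iff v).1 hv).resolve_right (not_not.2 hv1), hagree.1⟩

theorem IsIntersecting.exists_eq_vertSet (h2 : (2 : F) ≠ 0) {k : ℕ} (hk : 1 ≤ k)
    (hF : Fintype.card F = p ^ k) {S : Set (GammaL p F)} (hS : IsIntersecting (NonzeroVec F) S)
    (hcard : S.ncard = k * p ^ k * (p ^ k - 1))
    (h1 : fiber S 1 = vertFix (firstVec F) (firstVec F)) :
    ∃ a : Subgroup.zpowers (frob p F) → Fˣ, a 1 = 1 ∧ Compatible a ∧ S = vertSet a := by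
  have hex : ∀ σ, ∃ x : Fˣ, (σ = 1 → x = 1) ∧
      fiber S σ = vertFix (firstVec F) ![(x : F), 0] := by
    intro σ
    by_cases hσ : σ = 1
    · subst hσ
      exact ⟨1, fun _ => rfl, h1⟩
    · obtain ⟨u, w, hu, hw, hT⟩ := hS.exists_fiber_eq hk hF hcard σ
      obtain ⟨x, hx⟩ := exists_unit_eq_vertFix_of_agree h2 (σ := σ.1) (by simpa using hσ) hu hw hT
        (fun A hA B hB => (isIntersecting_iff S).1 hS ⟨A, 1⟩ (h1.symm ▸ hA :) ⟨B, σ⟩ hB)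
      exact ⟨x, fun h => absurd h hσ, hx⟩
  choose a ha1 ha using hex
  have hSa : S = vertSet a := by
    ext g
    have h := Set.ext_iff.1 ((ha g.right).trans (fiber_vertSet a g.right).symm) g.left
    exact h
  exact ⟨a, ha1 1 rfl, compatible_of_isIntersecting_vertSet h2 (hSa ▸ hS), hSa⟩

theorem IsIntersecting.exists_eq_horSet (h2 : (2 : F) ≠ 0) {k : ℕ} (hk : 1 ≤ k)
    (hF : Fintype.card F = p ^ k) {S : Set (GammaL p F)} (hS : IsIntersecting (NonzeroVec F) S)
    (hcard : S.ncard = k * p ^ k * (p ^ k - 1))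
    (h1 : fiber S 1 = horFix (firstVec F) (firstVec F)) :
    ∃ d : Subgroup.zpowers (frob p F) → Fˣ, d 1 = 1 ∧ Compatible d ∧ S = horSet d := by
  obtain ⟨a, ha1, ha, hSa⟩ := hS.preimage_semilinearTwist.exists_eq_vertSet h2 hk hF
    ((ncard_preimage_semilinearTwist S).trans hcard) (by
      ext A
      change detTwist A ∈ fiber S 1 ↔ _
      rw [h1, horFix_eq_preimage, Set.mem_preimage, detTwist_involutive A])
  refine ⟨a⁻¹, by simp [ha1], ha.inv, ?_⟩
  rw [horSet_eq_preimage, inv_inv, ← hSa, ← Set.preimage_comp,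
    semilinearTwist_involutive.comp_self, Set.preimage_id]

theorem IsIntersecting.image_conj_translate {S : Set (GammaL p F)}
    (hS : IsIntersecting (NonzeroVec F) S) (f g : GammaL p F) :
    IsIntersecting (NonzeroVec F) ((fun s => g * (f⁻¹ * s) * g⁻¹) '' S) := by
  rintro _ ⟨s, hs, rfl⟩ _ ⟨t, ht, rfl⟩
  obtain ⟨w, hw⟩ := hS s hs t ht
  refine ⟨g • w, ?_⟩
  simp only [mul_smul, inv_smul_smul, hw]

theorem ncard_image_conj_translate (S : Set (GammaL p F)) (f g : GammaL p F) :
    ((fun s => g * (f⁻¹ * s) * g⁻¹) '' S).ncard = S.ncard :=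
  Set.ncard_image_of_injective _ fun s t h => by simpa using h

theorem fiber_one_image_conj_translate (S : Set (GammaL p F)) (f : GammaL p F)
    (g A : GL (Fin 2) F) :
    A ∈ fiber ((fun s => ofGL p g * (f⁻¹ * s) * (ofGL p g)⁻¹) '' S) 1 ↔
      g⁻¹ * A * g ∈ fiber ((fun s => 1 * (f⁻¹ * s) * 1⁻¹) '' S) 1 := by
  have hA : (⟨A, 1⟩ : GammaL p F) = ofGL p A := rfl
  have hA' : (⟨g⁻¹ * A * g, 1⟩ : GammaL p F) = (ofGL p g)⁻¹ * ofGL p A * ofGL p g := by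
    simp only [ofGL, ← map_inv, ← map_mul]
    rfl
  simp only [fiber, Set.mem_ofPred_eq, Set.mem_image, hA, hA', one_mul, inv_one, mul_one]
  refine exists_congr fun s => and_congr_right fun _ => ?_
  rw [mul_inv_eq_iff_eq_mul, eq_comm, ← inv_mul_eq_iff_eq_mul, ← mul_assoc, eq_comm]

theorem IsIntersecting.exists_conj_eq (h2 : (2 : F) ≠ 0) {k : ℕ} (hk : 1 ≤ k)
    (hF : Fintype.card F = p ^ k) {S : Set (GammaL p F)} (hS : IsIntersecting (NonzeroVec F) S)
    (hcard : S.ncard = k * p ^ k * (p ^ k - 1)) {f : GammaL p F} (hf : f ∈ S) :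
    ∃ (g : GammaL p F) (a : Subgroup.zpowers (frob p F) → Fˣ), a 1 = 1 ∧ Compatible a ∧
      ((fun s => g * (f⁻¹ * s) * g⁻¹) '' S = vertSet a ∨
        (fun s => g * (f⁻¹ * s) * g⁻¹) '' S = horSet a) := by
  obtain ⟨u, w, hu, hw, hfib⟩ := (hS.image_conj_translate f 1).exists_fiber_eq hk hF
    ((ncard_image_conj_translate S f 1).trans hcard) 1
  -- Translation by `f⁻¹` puts the identity in the fiber over 1, which forces `w = u`.
  have hone : (1 : GL (Fin 2) F) ∈ fiber ((fun s => 1 * (f⁻¹ * s) * 1⁻¹) '' S) 1 :=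
    ⟨f, hf, by simp only [inv_mul_cancel, one_mul, inv_one]; rfl⟩
  have hwu : w = u := by
    rcases hfib with h | h <;> rw [h] at hone
    · exact (by simpa only [vertFix, Set.mem_ofPred_eq, Units.val_one, one_mulVec] using hone : u = w).symm
    · exact (by simpa only [horFix, Set.mem_ofPred_eq, Units.val_one, one_mulVec, det_one, one_smul]
        using hone : u = w).symm
  subst hwu
  obtain ⟨g, hg⟩ := exists_GL_mulVec_eq_firstVec hu
  have hinj : Function.Injective (g⁻¹.1 *ᵥ ·) := by
    intro x y hxy
    have := congrArg (g.1 *ᵥ ·) hxy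
    simpa only [mulVec_mulVec, ← Units.val_mul, mul_inv_cancel, Units.val_one, one_mulVec]
      using this
  have hg' : g⁻¹.1 *ᵥ firstVec F = w := by
    rw [← hg, mulVec_mulVec, ← Units.val_mul]; simp
  refine ⟨ofGL p g, ?_⟩
  rcases hfib with h | h
  · obtain ⟨a, ha1, ha, hSa⟩ := (hS.image_conj_translate f (ofGL p g)).exists_eq_vertSet h2 hk hF
      ((ncard_image_conj_translate S f _).trans hcard) (by
        ext A
        rw [fiber_one_image_conj_translate, h, vertFix, vertFix, Set.mem_ofPred_eq,
          Set.mem_ofPred_eq, Units.val_mul, Units.val_mul, ← mulVec_mulVec, ← mulVec_mulVec, hg,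
          ← hg', hinj.eq_iff])
    exact ⟨a, ha1, ha, Or.inl hSa⟩
  · obtain ⟨a, ha1, ha, hSa⟩ := (hS.image_conj_translate f (ofGL p g)).exists_eq_horSet h2 hk hF
      ((ncard_image_conj_translate S f _).trans hcard) (by
        ext A
        have hdet : (g⁻¹ * A * g).1.det = A.1.det := by
          rw [Units.val_mul, Units.val_mul, det_mul, det_mul, mul_right_comm, ← det_mul,
            ← Units.val_mul]
          simp
        rw [fiber_one_image_conj_translate, h, horFix, horFix, Set.mem_ofPred_eq,
          Set.mem_ofPred_eq, hdet, Units.val_mul, Units.val_mul, ← mulVec_mulVec,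
          ← mulVec_mulVec, hg, ← hg', ← mulVec_smul, hinj.eq_iff])
    exact ⟨a, ha1, ha, Or.inr hSa⟩

end SemilinearGroup

/-! ### Discrete logarithms and admissible sequences. -/

section Exponents

theorem one_le_pow_of_prime {p : ℕ} [Fact p.Prime] (j : ℕ) : 1 ≤ p ^ j :=
  Nat.one_le_pow _ _ (Fact.out : p.Prime).pos

theorem pow_sub_one_pos {p : ℕ} [Fact p.Prime] {j : ℕ} (hj : 1 ≤ j) : 0 < p ^ j - 1 :=
  Nat.sub_pos_of_lt (Nat.one_lt_pow (by omega) (Fact.out : p.Prime).one_lt)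

theorem cast_pow_sub_one {p : ℕ} [Fact p.Prime] (n j : ℕ) :
    ((p ^ j - 1 : ℕ) : ZMod n) = (p : ZMod n) ^ j - 1 := by
  rw [Nat.cast_sub (one_le_pow_of_prime j)]
  push_cast
  rfl

theorem cast_pow_eq_one {p : ℕ} [Fact p.Prime] (k : ℕ) : (p : ZMod (p ^ k - 1)) ^ k = 1 := by
  have h := cast_pow_sub_one (p := p) (p ^ k - 1) k
  rw [ZMod.natCast_self] at h
  exact (sub_eq_zero.1 h.symm)

variable {p : ℕ} [Fact p.Prime] {G : Type*} [Group G] {ω : G}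

theorem pow_eq_pow_iff_cast_eq {n : ℕ} (hω : orderOf ω = n) (a b : ℕ) :
    ω ^ a = ω ^ b ↔ (a : ZMod n) = b := by
  rw [pow_eq_pow_iff_modEq, hω, ZMod.natCast_eq_natCast_iff]

/-- With `c = ω ^ s` the equation says that the difference of the two exponents is `s * p ^ j * (p ^
(j' - j) - 1)` in `ZMod (p ^ k - 1)`. There `p` is invertible because `p ^ k = 1`, so `s * p ^ j` is
an arbitrary element. -/
theorem exists_agree_iff_dvd {k : ℕ} (hk : 1 ≤ k) (hord : orderOf ω = p ^ k - 1)
    (hω : ∀ x : G, x ∈ Subgroup.zpowers ω) {j j' : ℕ} (hjj' : j < j') (hj' : j' < k) (r r' : ℕ) :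
    (∃ c : G, ω ^ (r * (p ^ j - 1)) * c ^ p ^ j = ω ^ (r' * (p ^ j' - 1)) * c ^ p ^ j') ↔
      ((p : ZMod (p ^ k - 1)) ^ (j' - j) - 1) ∣
        ((r : ZMod (p ^ k - 1)) * ((p : ZMod (p ^ k - 1)) ^ j - 1)
          - (r' : ZMod (p ^ k - 1)) * ((p : ZMod (p ^ k - 1)) ^ j' - 1)) := by
  have hpos := pow_sub_one_pos (p := p) hk
  have : NeZero (p ^ k - 1) := ⟨hpos.ne'⟩
  have hsplit : (p : ZMod (p ^ k - 1)) ^ j' = (p : ZMod (p ^ k - 1)) ^ j * p ^ (j' - j) := by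
    rw [← pow_add, Nat.add_sub_cancel' hjj'.le]
  have hstep : ∀ s : ℕ, ω ^ (r * (p ^ j - 1)) * (ω ^ s) ^ p ^ j =
      ω ^ (r' * (p ^ j' - 1)) * (ω ^ s) ^ p ^ j' ↔
      (r : ZMod (p ^ k - 1)) * ((p : ZMod (p ^ k - 1)) ^ j - 1) + s * p ^ j =
        (r' : ZMod (p ^ k - 1)) * ((p : ZMod (p ^ k - 1)) ^ j' - 1) + s * p ^ j' := by
    intro s
    rw [← pow_mul, ← pow_mul, ← pow_add, ← pow_add, pow_eq_pow_iff_cast_eq hord]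
    simp only [Nat.cast_add, Nat.cast_mul, cast_pow_sub_one, Nat.cast_pow]
  constructor
  · rintro ⟨c, hc⟩
    have hfin : IsOfFinOrder ω := orderOf_pos_iff.1 (hord ▸ hpos)
    obtain ⟨s, rfl⟩ := (hfin.mem_powers_iff_mem_zpowers).2 (hω c)
    have h := (hstep s).1 hc
    refine ⟨s * p ^ j, ?_⟩
    rw [hsplit] at h ⊢
    linear_combination h
  · rintro ⟨e, he⟩
    have hinv : (p : ZMod (p ^ k - 1)) ^ (k - j) * p ^ j = 1 := by
      rw [← pow_add, Nat.sub_add_cancel (hjj'.trans hj').le, cast_pow_eq_one]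
    refine ⟨ω ^ (e * (p : ZMod (p ^ k - 1)) ^ (k - j)).val, (hstep _).2 ?_⟩
    rw [ZMod.natCast_zmod_val]
    rw [hsplit] at he ⊢
    linear_combination he - ((p : ZMod (p ^ k - 1)) ^ (j' - j) - 1) * e * hinv

/-- Since `p ^ gcd j k - 1` divides `p ^ j - 1`, changing `s` by a multiple of the modulus changes
the exponent by a multiple of the order of `ω`. This justifies the range imposed on `r j`. -/
theorem pow_mul_pow_sub_one_mod {p : ℕ} {k : ℕ} (hord : orderOf ω = p ^ k - 1) (j s : ℕ) :
    ω ^ ((s % ((p ^ k - 1) / (p ^ Nat.gcd j k - 1))) * (p ^ j - 1)) = ω ^ (s * (p ^ j - 1)) := by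
  set M := (p ^ k - 1) / (p ^ Nat.gcd j k - 1) with hM
  have hdvd : ∀ {m}, Nat.gcd j k ∣ m → p ^ Nat.gcd j k - 1 ∣ p ^ m - 1 := by
    rintro m ⟨n, rfl⟩
    have := Nat.sub_dvd_pow_sub_pow (p ^ Nat.gcd j k) 1 n
    rwa [one_pow, ← pow_mul] at this
  have hMk : M * (p ^ Nat.gcd j k - 1) = p ^ k - 1 :=
    Nat.div_mul_cancel (hdvd (Nat.gcd_dvd_right j k))
  obtain ⟨e, he⟩ := hdvd (Nat.gcd_dvd_left j k)
  conv_rhs => rw [← Nat.mod_add_div s M, add_mul, pow_add]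
  rw [he, show M * (s / M) * ((p ^ Nat.gcd j k - 1) * e) =
    (M * (p ^ Nat.gcd j k - 1)) * ((s / M) * e) by ring, hMk, ← hord, pow_mul ω (orderOf ω),
    pow_orderOf_eq_one, one_pow, mul_one]

theorem exists_admissible {k : ℕ} (hk : 1 ≤ k) (hord : orderOf ω = p ^ k - 1)
    (hω : ∀ x : G, x ∈ Subgroup.zpowers ω) {b : ℕ → G} (hb0 : b 0 = 1)
    (hb : ∀ j j', j < j' → j' < k → ∃ c : G, b j * c ^ p ^ j = b j' * c ^ p ^ j') :
    ∃ r : ℕ → ℕ, Admissible p k r ∧ ∀ j < k, b j = ω ^ (r j * (p ^ j - 1)) := by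
  have hpos := pow_sub_one_pos (p := p) hk
  have hfin : IsOfFinOrder ω := orderOf_pos_iff.1 (hord ▸ hpos)
  have hs : ∀ j, ∃ s : ℕ, j < k → b j = ω ^ (s * (p ^ j - 1)) := by
    intro j
    rcases Nat.eq_zero_or_pos j with rfl | hj0
    · exact ⟨0, fun _ => by simpa using hb0⟩
    by_cases hj : j < k
    -- Comparison with index 0, where `b 0 = 1`, gives `c = b j * c ^ p ^ j`, so `b j` is the `(p ^
    -- j - 1)`-th power of `c⁻¹`.
    · obtain ⟨c, hc⟩ := hb 0 j hj0 hj
      obtain ⟨s, hs⟩ := (hfin.mem_powers_iff_mem_zpowers).2 (hω c⁻¹)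
      refine ⟨s, fun _ => ?_⟩
      have hs' : ω ^ s = c⁻¹ := hs
      rw [pow_mul, hs', inv_pow, eq_inv_iff_mul_eq_one]
      rw [hb0, pow_zero, pow_one, one_mul] at hc
      apply mul_right_cancel (b := c)
      rw [mul_assoc, ← pow_succ, Nat.sub_add_cancel (one_le_pow_of_prime j), ← hc, one_mul]
    · exact ⟨0, fun h => absurd h hj⟩
  choose s hs using hs
  have hM : ∀ j, 0 < (p ^ k - 1) / (p ^ Nat.gcd j k - 1) := by
    intro j
    have hg : 1 ≤ Nat.gcd j k := Nat.gcd_pos_of_pos_right j hk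
    refine Nat.div_pos ?_ (pow_sub_one_pos hg)
    exact Nat.sub_le_sub_right (Nat.pow_le_pow_right (Fact.out : p.Prime).pos
      (Nat.gcd_le_right j hk)) 1
  have hr : ∀ j < k, b j =
      ω ^ ((s j % ((p ^ k - 1) / (p ^ Nat.gcd j k - 1))) * (p ^ j - 1)) := by
    intro j hj
    rw [pow_mul_pow_sub_one_mod hord, hs j hj]
  refine ⟨fun j => s j % ((p ^ k - 1) / (p ^ Nat.gcd j k - 1)), ⟨?_, ?_, ?_⟩, hr⟩
  -- For `j = 0` the gcd is `k`, so the modulus is 1 and the remainder is 0.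
  · simp only [Nat.gcd_zero_left]
    rw [Nat.div_self hpos, Nat.mod_one]
  · intro j _
    exact Nat.le_sub_one_of_lt (Nat.mod_lt _ (hM j))
  · intro j j' hjj' hj'
    rw [← exists_agree_iff_dvd hk hord hω hjj' hj', ← hr j (hjj'.trans hj'), ← hr j' hj']
    exact hb j j' hjj' hj'

theorem Admissible.exists_agree {k : ℕ} (hk : 1 ≤ k) (hord : orderOf ω = p ^ k - 1)
    (hω : ∀ x : G, x ∈ Subgroup.zpowers ω) {r : ℕ → ℕ} (hr : Admissible p k r) {j j' : ℕ}
    (hjj' : j < j') (hj' : j' < k) :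
    ∃ c : G, ω ^ (r j * (p ^ j - 1)) * c ^ p ^ j = ω ^ (r j' * (p ^ j' - 1)) * c ^ p ^ j' :=
  (exists_agree_iff_dvd hk hord hω hjj' hj' _ _).2 (hr.2.2 j j' hjj' hj')

end Exponents

/-! ### Vertical and horizontal types as compatible families. -/

section Types

theorem entrywise_upperTri {F : Type*} [Field F] (σ : RingAut F) (x : Fˣ) (z : F) (y : Fˣ) :
    entrywise F σ (upperTri x z y) =
      upperTri (Units.map (σ : F →* F) x) (σ z) (Units.map (σ : F →* F) y) := by
  apply Units.ext
  ext i j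
  fin_cases i <;> fin_cases j <;> simp [entrywise, upperTri_val]

variable {p : ℕ} [Fact p.Prime] {F : Type*} [Field F] [Fintype F] [CharP F p]

variable (p F) in
/-- The power `φ ^ j` of the Frobenius automorphism, in the group it generates. -/
noncomputable def frobZPow (j : ℕ) : Subgroup.zpowers (frob p F) := ⟨frob p F ^ j, j, by simp⟩

theorem frobZPow_apply (j : ℕ) (x : F) : (frobZPow p F j).1 x = x ^ p ^ j := frob_pow_apply j x

theorem exists_frobZPow_eq {k : ℕ} (hk : 1 ≤ k) (hF : Fintype.card F = p ^ k)
    (σ : Subgroup.zpowers (frob p F)) : ∃ j < k, frobZPow p F j = σ := by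
  classical
  obtain ⟨σ, hσ⟩ := σ
  rw [mem_zpowers_iff_mem_range_orderOf, orderOf_frob hk hF, Finset.mem_image] at hσ
  obtain ⟨j, hj, rfl⟩ := hσ
  exact ⟨j, Finset.mem_range.1 hj, rfl⟩

theorem frobZPow_inj {k : ℕ} (hk : 1 ≤ k) (hF : Fintype.card F = p ^ k) {i j : ℕ} (hi : i < k)
    (hj : j < k) (h : frobZPow p F i = frobZPow p F j) : i = j :=
  pow_injOn_Iio_orderOf (x := frob p F) (by simpa [orderOf_frob hk hF] using hi)
    (by simpa [orderOf_frob hk hF] using hj) (congrArg Subtype.val h)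

theorem zpowers_frob_apply_comm (σ τ : Subgroup.zpowers (frob p F)) (x : F) :
    σ.1 (τ.1 x) = τ.1 (σ.1 x) := by
  obtain ⟨_, m, rfl⟩ := σ
  obtain ⟨_, n, rfl⟩ := τ
  exact DFunLike.congr_fun (zpow_mul_comm (frob p F) m n) x

/-- The family `σ ↦ σ (b σ)`. -/
def selfApply (b : Subgroup.zpowers (frob p F) → Fˣ) : Subgroup.zpowers (frob p F) → Fˣ :=
  fun σ => Units.map (σ.1 : F →* F) (b σ)

theorem selfApply_val (b : Subgroup.zpowers (frob p F) → Fˣ) (σ) :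
    (selfApply b σ : F) = σ.1 (b σ) := rfl

theorem exists_selfApply_eq (d : Subgroup.zpowers (frob p F) → Fˣ) :
    ∃ b, selfApply b = d := by
  refine ⟨fun σ => Units.map (σ.1.symm : F →* F) (d σ), ?_⟩
  ext σ
  simp [selfApply_val]

/-- Needed because in `hSet` the Frobenius power stands to the left of the matrix and so acts on the
entry `ω ^ t`. As the automorphisms commute, `σ (b σ * c) = τ (b τ * c)` is solvable exactly when `b
σ * σ c = b τ * τ c` is. -/
theorem compatible_selfApply_iff {b : Subgroup.zpowers (frob p F) → Fˣ} :
    Compatible (selfApply b) ↔ Compatible b := by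
  constructor <;> intro h σ τ <;> obtain ⟨c, hc, hcc⟩ := h σ τ
  · rw [selfApply_val, selfApply_val, ← map_mul, ← map_mul] at hcc
    refine ⟨σ.1.symm (b τ * c), by simpa using hc, ?_⟩
    have h1 : τ.1 (σ.1.symm (b τ * c)) = b σ * c := by
      apply σ.1.injective
      rw [zpowers_frob_apply_comm, RingEquiv.apply_symm_apply, hcc]
    rw [h1, RingEquiv.apply_symm_apply]
    ring
  · refine ⟨σ.1 c / b τ, by simpa using hc, ?_⟩
    rw [selfApply_val, selfApply_val, ← map_mul, ← map_mul, mul_div_cancel₀ _ (b τ).ne_zero,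
      ← mul_div_assoc, hcc, mul_div_cancel_left₀ _ (b τ).ne_zero, zpowers_frob_apply_comm]

theorem compatible_iff_exists_admissible {k : ℕ} (hk : 1 ≤ k) (hF : Fintype.card F = p ^ k)
    {ω : Fˣ} (hω : ∀ x : Fˣ, x ∈ Subgroup.zpowers ω) (a : Subgroup.zpowers (frob p F) → Fˣ) :
    (a 1 = 1 ∧ Compatible a) ↔
      ∃ r, Admissible p k r ∧ ∀ j < k, a (frobZPow p F j) = ω ^ (r j * (p ^ j - 1)) := by
  classical
  have hord : orderOf ω = p ^ k - 1 := by
    rw [orderOf_eq_card_of_forall_mem_zpowers hω, Nat.card_eq_fintype_card,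
      Fintype.card_units, hF]
  constructor
  · rintro ⟨ha1, ha⟩
    refine exists_admissible hk hord hω (b := fun j => a (frobZPow p F j)) ha1 ?_
    intro j j' _ _
    obtain ⟨c, hc, h⟩ := ha (frobZPow p F j) (frobZPow p F j')
    refine ⟨Units.mk0 c hc, ?_⟩
    ext
    simpa [frobZPow_apply] using h
  · rintro ⟨r, hr, har⟩
    refine ⟨(har 0 (by omega)).trans (by simp), ?_⟩
    have hlt : ∀ j j', j < j' → j' < k → ∃ c : F, c ≠ 0 ∧
        a (frobZPow p F j) * (frobZPow p F j).1 c =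
          a (frobZPow p F j') * (frobZPow p F j').1 c := by
      intro j j' hjj' hj'
      obtain ⟨c, hc⟩ := hr.exists_agree hk hord hω hjj' hj'
      refine ⟨c, c.ne_zero, ?_⟩
      rw [← har j (hjj'.trans hj'), ← har j' hj'] at hc
      simpa [frobZPow_apply] using congrArg Units.val hc
    intro σ τ
    obtain ⟨j, hj, rfl⟩ := exists_frobZPow_eq hk hF σ
    obtain ⟨j', hj', rfl⟩ := exists_frobZPow_eq hk hF τ
    rcases lt_trichotomy j j' with h | rfl | h
    · exact hlt j j' h hj'
    · exact ⟨1, one_ne_zero, rfl⟩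
    · obtain ⟨c, hc, hcc⟩ := hlt j' j h hj
      exact ⟨c, hc, hcc.symm⟩

theorem exists_family_eq {k : ℕ} (hk : 1 ≤ k) (hF : Fintype.card F = p ^ k) (b : ℕ → Fˣ) :
    ∃ a : Subgroup.zpowers (frob p F) → Fˣ, ∀ j < k, a (frobZPow p F j) = b j := by
  choose i hi hiσ using exists_frobZPow_eq (p := p) (F := F) hk hF
  refine ⟨fun σ => b (i σ), fun j hj => ?_⟩
  exact congrArg b (frobZPow_inj hk hF (hi _) hj (hiσ _))

theorem mem_vSet_iff {ω : Fˣ} {i j : ℕ} {g : GammaL p F} :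
    g ∈ vSet p ω i j ↔
      g.right = frobZPow p F j ∧ g.left.1 1 0 = 0 ∧ g.left.1 0 0 = (ω ^ i : Fˣ) := by
  have hprod : ∀ (x : Fˣ) (z : F) (y : Fˣ), ofGL p (GeneralLinearGroup.scalar (Fin 2) x) *
      frobPow p F j * ofGL p (upperTri 1 z y) =
      ⟨GeneralLinearGroup.scalar (Fin 2) x *
        entrywise F (frobZPow p F j).1 (upperTri 1 z y), frobZPow p F j⟩ := by
    intro x z y
    apply SemidirectProduct.ext
    · simp [ofGL, frobPow, frobZPow]
    · simp [ofGL, frobPow, frobZPow]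
  have hleft : ∀ (x : Fˣ) (z : F) (y : Fˣ), GeneralLinearGroup.scalar (Fin 2) x *
        entrywise F (frobZPow p F j).1 (upperTri 1 z y) =
      upperTri x (x * (frobZPow p F j).1 z)
        (x * Units.map ((frobZPow p F j).1 : F →* F) y) := by
    intro x z y
    rw [entrywise_upperTri]
    apply Units.ext
    ext m n
    fin_cases m <;> fin_cases n <;>
      simp [upperTri_val, GeneralLinearGroup.scalar, diagonal_mul]
  constructor
  · rintro ⟨z, y, rfl⟩
    rw [hprod, hleft]
    simp [upperTri_val]
  · rintro ⟨hr, h0, h1⟩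
    obtain ⟨x, z, y, hxyz⟩ := exists_eq_upperTri h0
    have hx : x = ω ^ i := by
      ext
      rw [← h1, hxyz]
      rfl
    subst hx
    refine ⟨(frobZPow p F j).1.symm (z / (ω ^ i : Fˣ)),
      Units.map ((frobZPow p F j).1.symm : F →* F) (y / ω ^ i), ?_⟩
    rw [hprod, hleft]
    refine SemidirectProduct.ext ?_ hr
    rw [hxyz]
    congr 1
    · rw [RingEquiv.apply_symm_apply, mul_div_cancel₀ _ (ω ^ i).ne_zero]
    · ext
      simp
      field_simp

theorem mem_hSet_iff {ω : Fˣ} {t j : ℕ} {g : GammaL p F} :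
    g ∈ hSet p ω t j ↔ g.right = frobZPow p F j ∧ g.left.1 1 0 = 0 ∧
      g.left.1 1 1 = (frobZPow p F j).1 (ω ^ t : Fˣ) := by
  have hprod : ∀ (x : Fˣ) (z : F), frobPow p F j * ofGL p (upperTri x z (ω ^ t)) =
      ⟨upperTri (Units.map ((frobZPow p F j).1 : F →* F) x) ((frobZPow p F j).1 z)
        (Units.map ((frobZPow p F j).1 : F →* F) (ω ^ t)), frobZPow p F j⟩ := by
    intro x z
    rw [← entrywise_upperTri]
    apply SemidirectProduct.ext
    · simp [ofGL, frobPow, frobZPow]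
    · simp [ofGL, frobPow, frobZPow]
  constructor
  · rintro ⟨x, z, rfl⟩
    rw [hprod]
    simp [upperTri_val]
  · rintro ⟨hr, h0, h1⟩
    obtain ⟨x, z, y, hxyz⟩ := exists_eq_upperTri h0
    refine ⟨Units.map ((frobZPow p F j).1.symm : F →* F) x, (frobZPow p F j).1.symm z, ?_⟩
    rw [hprod]
    refine SemidirectProduct.ext ?_ hr
    rw [hxyz]
    congr 1
    · ext
      simp
    · rw [RingEquiv.apply_symm_apply]
    · ext
      rw [hxyz] at h1
      exact h1

theorem iUnion_vSet_eq_vertSet {k : ℕ} (hk : 1 ≤ k) (hF : Fintype.card F = p ^ k) {ω : Fˣ}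
    {e : ℕ → ℕ} {a : Subgroup.zpowers (frob p F) → Fˣ}
    (ha : ∀ j < k, a (frobZPow p F j) = ω ^ e j) :
    ⋃ j ∈ Finset.range k, vSet p ω (e j) j = vertSet a := by
  ext g
  simp only [Set.mem_iUnion, Finset.mem_range, mem_vSet_iff, exists_prop]
  constructor
  · rintro ⟨j, hj, hr, h0, h1⟩
    exact ⟨h0, by rw [h1, hr, ha j hj]⟩
  · rintro ⟨h0, h1⟩
    obtain ⟨j, hj, hr⟩ := exists_frobZPow_eq hk hF g.right
    exact ⟨j, hj, hr.symm, h0, by rw [h1, ← hr, ha j hj]⟩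

theorem iUnion_hSet_eq_horSet {k : ℕ} (hk : 1 ≤ k) (hF : Fintype.card F = p ^ k) {ω : Fˣ}
    {e : ℕ → ℕ} {b : Subgroup.zpowers (frob p F) → Fˣ}
    (hb : ∀ j < k, b (frobZPow p F j) = ω ^ e j) :
    ⋃ j ∈ Finset.range k, hSet p ω (e j) j = horSet (selfApply b) := by
  ext g
  simp only [Set.mem_iUnion, Finset.mem_range, mem_hSet_iff, exists_prop]
  constructor
  · rintro ⟨j, hj, hr, h0, h1⟩
    exact ⟨h0, by rw [h1, hr, selfApply_val, hb j hj]⟩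
  · rintro ⟨h0, h1⟩
    obtain ⟨j, hj, hr⟩ := exists_frobZPow_eq hk hF g.right
    exact ⟨j, hj, hr.symm, h0, by rw [h1, ← hr, selfApply_val, hb j hj]⟩

theorem isVerticalType_iff {k : ℕ} (hk : 1 ≤ k) (hF : Fintype.card F = p ^ k) {ω : Fˣ}
    (hω : ∀ x : Fˣ, x ∈ Subgroup.zpowers ω) (S : Set (GammaL p F)) :
    IsVerticalType k ω S ↔ ∃ a, a 1 = 1 ∧ Compatible a ∧ S = vertSet a := by
  constructor
  · rintro ⟨r, hr, rfl⟩
    obtain ⟨a, ha⟩ := exists_family_eq (p := p) hk hF fun j => ω ^ (r j * (p ^ j - 1))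
    obtain ⟨ha1, hac⟩ := (compatible_iff_exists_admissible hk hF hω a).2 ⟨r, hr, ha⟩
    exact ⟨a, ha1, hac, iUnion_vSet_eq_vertSet hk hF ha⟩
  · rintro ⟨a, ha1, hac, rfl⟩
    obtain ⟨r, hr, ha⟩ := (compatible_iff_exists_admissible hk hF hω a).1 ⟨ha1, hac⟩
    exact ⟨r, hr, (iUnion_vSet_eq_vertSet hk hF ha).symm⟩

theorem isHorizontalType_iff {k : ℕ} (hk : 1 ≤ k) (hF : Fintype.card F = p ^ k) {ω : Fˣ}
    (hω : ∀ x : Fˣ, x ∈ Subgroup.zpowers ω) (S : Set (GammaL p F)) :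
    IsHorizontalType k ω S ↔ ∃ d, d 1 = 1 ∧ Compatible d ∧ S = horSet d := by
  have hone : ∀ b : Subgroup.zpowers (frob p F) → Fˣ, selfApply b 1 = b 1 := fun b => by
    ext; rfl
  constructor
  · rintro ⟨t, ht, rfl⟩
    obtain ⟨b, hb⟩ := exists_family_eq (p := p) hk hF fun j => ω ^ (t j * (p ^ j - 1))
    obtain ⟨hb1, hbc⟩ := (compatible_iff_exists_admissible hk hF hω b).2 ⟨t, ht, hb⟩
    exact ⟨selfApply b, (hone b).trans hb1, compatible_selfApply_iff.2 hbc,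
      iUnion_hSet_eq_horSet hk hF hb⟩
  · rintro ⟨d, hd1, hdc, rfl⟩
    obtain ⟨b, rfl⟩ := exists_selfApply_eq d
    obtain ⟨t, ht, hb⟩ := (compatible_iff_exists_admissible hk hF hω b).1
      ⟨(hone b).symm.trans hd1, compatible_selfApply_iff.1 hdc⟩
    exact ⟨t, ht, (iUnion_hSet_eq_horSet hk hF hb).symm⟩

theorem isMaximumIntersecting_iff {k : ℕ} (hk : 1 ≤ k) (hF : Fintype.card F = p ^ k)
    (S : Set (GammaL p F)) : IsMaximumIntersecting (NonzeroVec F) S ↔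
      IsIntersecting (NonzeroVec F) S ∧ S.ncard = k * p ^ k * (p ^ k - 1) := by
  constructor
  · rintro ⟨hS, hmax⟩
    refine ⟨hS, le_antisymm (hS.ncard_le hk hF) ?_⟩
    -- The constant family 1 shows that the bound is attained.
    have hone : Compatible (1 : Subgroup.zpowers (frob p F) → Fˣ) :=
      fun σ τ => ⟨1, one_ne_zero, by simp⟩
    exact (ncard_vertSet hk hF 1).symm.le.trans (hmax _ hone.isIntersecting_vertSet)
  · rintro ⟨hS, hcard⟩
    exact ⟨hS, fun T hT => (hT.ncard_le hk hF).trans_eq hcard.symm⟩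

end Types

/-! ### The main theorem. -/

theorem theorem1 (p : ℕ) [Fact p.Prime] (hp : Odd p) (k : ℕ) (hk : 1 ≤ k)
    (F : Type*) [Field F] [Fintype F] [CharP F p] (hF : Fintype.card F = p ^ k)
    (ω : Fˣ) (hω : ∀ x : Fˣ, x ∈ Subgroup.zpowers ω) :
    -- the EKR property, and the common size of the point stabilizers
    HasEKR (GammaL p F) (NonzeroVec F) ∧
    (∀ v : NonzeroVec F,
      Nat.card (MulAction.stabilizer (GammaL p F) v) = k * p ^ k * (p ^ k - 1)) ∧
    (∀ S : Set (GammaL p F), IsIntersecting (NonzeroVec F) S →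
      S.ncard ≤ k * p ^ k * (p ^ k - 1)) ∧
    -- the maximum intersecting sets are exactly those of size `k q (q - 1)`
    (∀ S : Set (GammaL p F), IsMaximumIntersecting (NonzeroVec F) S ↔
      IsIntersecting (NonzeroVec F) S ∧ S.ncard = k * p ^ k * (p ^ k - 1)) ∧
    -- translated to contain the identity, each of them is conjugate to one of the two types
    (∀ S : Set (GammaL p F), IsMaximumIntersecting (NonzeroVec F) S → ∀ f ∈ S,
      ∃ g : GammaL p F,
        IsVerticalType k ω ((fun s => g * (f⁻¹ * s) * g⁻¹) '' S) ∨
        IsHorizontalType k ω ((fun s => g * (f⁻¹ * s) * g⁻¹) '' S)) ∧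
    -- and all sets of the two types are maximum intersecting sets
    (∀ S : Set (GammaL p F), IsVerticalType k ω S ∨ IsHorizontalType k ω S →
      IsMaximumIntersecting (NonzeroVec F) S) := by
  have h2 : (2 : F) ≠ 0 := by
    intro h
    have hdvd : p ∣ 2 := (CharP.cast_eq_zero_iff F p 2).1 (by exact_mod_cast h)
    have hp2 := (Nat.prime_dvd_prime_iff_eq Fact.out Nat.prime_two).1 hdvd
    subst hp2
    exact absurd hp (by decide)
  refine ⟨fun S hS v => ?_, card_stabilizer_nonzeroVec hk hF, fun S hS => hS.ncard_le hk hF,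
    isMaximumIntersecting_iff hk hF, fun S hS f hf => ?_, fun S hS => ?_⟩
  · rw [card_stabilizer_nonzeroVec hk hF]
    exact hS.ncard_le hk hF
  · obtain ⟨hSi, hcard⟩ := (isMaximumIntersecting_iff hk hF S).1 hS
    obtain ⟨g, a, ha1, hac, h | h⟩ := hSi.exists_conj_eq h2 hk hF hcard hf
    · exact ⟨g, Or.inl ((isVerticalType_iff hk hF hω _).2 ⟨a, ha1, hac, h⟩)⟩
    · exact ⟨g, Or.inr ((isHorizontalType_iff hk hF hω _).2 ⟨a, ha1, hac, h⟩)⟩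
  · rw [isMaximumIntersecting_iff hk hF]
    rcases hS with hS | hS
    · obtain ⟨a, _, hac, rfl⟩ := (isVerticalType_iff hk hF hω _).1 hS
      exact ⟨hac.isIntersecting_vertSet, ncard_vertSet hk hF a⟩
    · obtain ⟨d, _, hdc, rfl⟩ := (isHorizontalType_iff hk hF hω _).1 hS
      exact ⟨hdc.isIntersecting_horSet, ncard_horSet hk hF d⟩
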